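/- **Setting.** Let $\mathcal V_n=\{-1,1\}^n$ with the hypercube graph structure ($x\sim y$ if $x,y$ differ in exactly one coordinate). For each $n$ let $(g_n(x))_{x\in\mathcal V_n}$ be independent standard Gaussian random variables; for all $n$ these are defined on a common probability space $(\Omega,\mathcal F,\mathbb P)$ (no assumption is made on the joint law for different $n$). Fix $c_\star>2$ and, for $n\ge2$, define $u_n$ by $\mathbb P(g_n(x)\le -u_n)=n^{-c_\star}$. Put $w_n(x)=e^{-\beta\sqrt n\,g_n(x)}$, and let $H_n(x)=\sqrt n\,g_n(x)$ if $g_n(x)\le -u_n$ and $H_n(x)=0$ otherwise. Call $x$ occupied if $g_n(x)\le-u_n$; let $\mathcal V_n^\star$ be the set of occupied vertices having at least one occupied neighbour, that is, the union of the connected components $C^\star_{n,l}$ of size at least $2$ of the graph of occupied vertices, and set $\mathcal V_n^\circ=\mathcal V_n\setminus\mathcal V_n^\star$. For a fixed environment let $J_n=(J_n(i))_{i\ge0}$ be the Markov chain on $\mathcal V_n$ started from the uniform distribution on $\mathcal V_n^\circ$, with transition probabilities $p_n(x,y)$, $y\sim x$, proportional to $e^{-\beta[H_n(y)-H_n(x)]^+}$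 (the jump chain of the Metropolis dynamics $X_n$), let $\lambda_n(x)=\frac1n\sum_{y\sim x}e^{-\beta[H_n(y)-H_n(x)]^+}$, and let $(e_{n,i})_{i\ge0}$ be independent mean one exponential random variables, independent of $J_n$. Write $\mathcal P_n$ for the joint law of $J_n$ and $(e_{n,i})$ given the environment. Given sequences $a_n,c_n$, let $K_n(t)$ be the least $k\ge0$ such that exactly $\lfloor a_nt\rfloor$ of $J_n(0),\dots,J_n(k-1)$ lie in $\mathcal V_n^\circ$, and let $T_{n,0}^\circ<T_{n,1}^\circ<\cdots$ be the times of the consecutive visits of $J_n$ to $\mathcal V_n^\circ$. For $t\ge0$ define the rescaled clock process, the rescaled front end clock process and the rescaled time spent in the components $C^\star_{n,l}$ by $$S_n(t)=\frac1{c_n}\sum_{i=0}^{K_n(t)-1}\frac{e_{n,i}}{\lambda_n(J_n(i))},\qquad S_n^\circ(t)=\frac1{c_n}\sum_{j=0}^{\lfloor a_nt\rfloor-1}\frac{e_{n,T^\circ_{n,j}}}{\lambda_n(J_n(T^\circ_{n,j}))},\qquad \widehat S_n(t)=\frac1{c_n}\sum_{i=0}^{K_n(t)-1}\frac{e_{n,i}}{\lambda_n(J_n(i))}\mathbf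 1_{\{J_n(i)\in\mathcal V_n^\star\}}.$$ Let $\rho_\infty$ be the Skorokhod $J_1$ metric on the space $D([0,\infty))$ of càdlàg functions, $\rho_\infty(x,y)=\sum_{m\ge1}2^{-m}\min\{1,d_m(\chi_mx,\chi_my)\}$, where $\chi_m(t)=\max\{0,\min\{1,m-t\}\}$, $d_m(x,y)=\inf_{\Lambda}\max\{\sup_{0\le s<t\le m}|\log\frac{\Lambda t-\Lambda s}{t-s}|,\ \sup_{0\le t\le m}|x(t)-y(\Lambda t)|\}$, and $\Lambda$ ranges over the increasing bijections of $[0,m]$ onto itself. **Theorem 3.3 (Remainder).** Let $c_\star>2$, $0<\varepsilon<1$ and $\beta>\beta_c(\varepsilon)=\sqrt{2\varepsilon\log2}$. Let $a_n$ and $c_n$ be sequences such that $$\lim_{n\to\infty}\frac{\log a_n}{n\log2}=\varepsilon,\qquad \lim_{n\to\infty}a_n\,\mathbb P(w_n(x)\ge c_n)=1 .$$ Then, $\mathbb P$-almost surely, for all $\delta>0$, $$\lim_{n\to\infty}\mathcal P_n\big(\rho_\infty(S_n,S_n^\circ)>\delta\big)=0,$$ and the time spent in the components $C^\star_{n,l}$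 is negligible: for all $t\ge0$ and $\delta>0$, $\lim_{n\to\infty}\mathcal P_n(\widehat S_n(t)>\delta)=0$. -/

import Mathlib

open MeasureTheory ProbabilityTheory Filter Topology Set
open scoped NNReal ENNReal

noncomputable section

namespace TruncatedREM

/-! ### The Skorokhod space `D([0,∞))` and its metric -/

/-- Right-continuous real functions on `[0,∞)` with left limits. -/
def IsCadlag (f : ℝ≥0 → ℝ) : Prop :=
  ∀ t, ContinuousWithinAt f (Ici t) t ∧ ∃ l, Tendsto f (𝓝[<] t) (𝓝 l)

/-- The space `D([0,∞))`. -/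
def SkorokhodSpace : Type := {f : ℝ≥0 → ℝ // IsCadlag f}

/-- Step functions of the form `t ↦ f ⌊a t⌋` are càdlàg. -/
theorem isCadlag_floor (a : ℝ) (f : ℕ → ℝ) :
    IsCadlag (fun t : ℝ≥0 => f ⌊a * (t : ℝ)⌋₊) := by
  intro t
  rcases le_or_gt a 0 with ha | ha
  · have h0 : (fun t : ℝ≥0 => f ⌊a * (t : ℝ)⌋₊) = fun _ => f 0 := by
      funext s
      rw [Nat.floor_of_nonpos (mul_nonpos_of_nonpos_of_nonneg ha s.coe_nonneg)]
    rw [h0]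
    exact ⟨continuousWithinAt_const, f 0, tendsto_const_nhds⟩
  have hcont : Continuous (fun s : ℝ≥0 => a * (s : ℝ)) := by fun_prop
  constructor
  · have h1 : ∀ᶠ s : ℝ≥0 in 𝓝[≥] t, f ⌊a * (t : ℝ)⌋₊ = f ⌊a * (s : ℝ)⌋₊ := by
      have h2 : ∀ᶠ s : ℝ≥0 in 𝓝[≥] t, a * (s : ℝ) < (⌊a * (t : ℝ)⌋₊ : ℝ) + 1 :=
        nhdsWithin_le_nhds ((hcont.tendsto t).eventually
          (eventually_lt_nhds (Nat.lt_floor_add_one _)))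
      filter_upwards [h2, self_mem_nhdsWithin] with s hs hts
      have hts' : (t : ℝ) ≤ s := NNReal.coe_le_coe.mpr hts
      have h3 : ⌊a * (s : ℝ)⌋₊ = ⌊a * (t : ℝ)⌋₊ := by
        rw [Nat.floor_eq_iff (by positivity)]
        exact ⟨(Nat.floor_le (by positivity)).trans (by gcongr), hs⟩
      rw [h3]
    exact tendsto_const_nhds.congr' h1
  · refine ⟨f (⌈a * (t : ℝ)⌉₊ - 1), ?_⟩
    have h1 : ∀ᶠ s : ℝ≥0 in 𝓝[<] t, f (⌈a * (t : ℝ)⌉₊ - 1) = f ⌊a * (s : ℝ)⌋₊ := by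
      have h2 : ∀ᶠ s : ℝ≥0 in 𝓝[<] t, (⌈a * (t : ℝ)⌉₊ : ℝ) - 1 < a * (s : ℝ) :=
        nhdsWithin_le_nhds ((hcont.tendsto t).eventually
          (eventually_gt_nhds (by
            have := Nat.ceil_lt_add_one (a := a * (t : ℝ)) (by positivity)
            linarith)))
      filter_upwards [h2, self_mem_nhdsWithin] with s hs hst
      have hst' : (s : ℝ) < t := NNReal.coe_lt_coe.mpr hst
      have hlt : a * (s : ℝ) < a * t := by gcongr
      have hpos : 1 ≤ ⌈a * (t : ℝ)⌉₊ :=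
        Nat.one_le_ceil_iff.mpr (lt_of_le_of_lt (by positivity) hlt)
      have h3 : ⌊a * (s : ℝ)⌋₊ = ⌈a * (t : ℝ)⌉₊ - 1 := by
        rw [Nat.floor_eq_iff (by positivity)]
        push_cast [hpos]
        exact ⟨hs.le, by linarith [Nat.le_ceil (a * (t : ℝ))]⟩
      rw [h3]
    exact tendsto_const_nhds.congr' h1

/-- The size `sup_{s < t} |log ((Λ t - Λ s) / (t - s))|` of a time change `Λ` of `[0,m]`, that is,
of an increasing bijection of `[0,m]` onto itself. -/
def timeChangeNorm {m : ℝ≥0} (Λ : Icc (0 : ℝ≥0) m ≃o Icc (0 : ℝ≥0) m) : ℝ≥0∞ :=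
  ⨆ (s : Icc (0 : ℝ≥0) m) (t : Icc (0 : ℝ≥0) m) (_ : s < t),
    ENNReal.ofReal |Real.log ((((Λ t : ℝ≥0) : ℝ) - ((Λ s : ℝ≥0) : ℝ)) /
      (((t : ℝ≥0) : ℝ) - ((s : ℝ≥0) : ℝ)))|

/-- Billingsley's (complete) Skorokhod `J₁` metric on `D([0,m])`, applied to the restrictions of
`x` and `y` to `[0,m]`. -/
def skorokhodDistOn (m : ℝ≥0) (x y : ℝ≥0 → ℝ) : ℝ≥0∞ :=
  ⨅ Λ : Icc (0 : ℝ≥0) m ≃o Icc (0 : ℝ≥0) m,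
    max (timeChangeNorm Λ) (⨆ t : Icc (0 : ℝ≥0) m, ENNReal.ofReal |x t - y (Λ t)|)

/-- The continuous cut-off equal to `1` on `[0,m-1]`, to `m - t` on `[m-1,m]`, and to `0` on
`[m,∞)`. -/
def cutoff (m : ℕ) (t : ℝ≥0) : ℝ := max 0 (min 1 ((m : ℝ) - (t : ℝ)))

/-- The Skorokhod `J₁` metric on `D([0,∞))`,
`∑_{m ≥ 1} 2^{-m} (1 ∧ d_m (x^m, y^m))` where `x^m` is `x` multiplied by the `m`-th cut-off and
`d_m` is the Skorokhod metric on `D([0,m])`. -/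
def skorokhodDist (x y : SkorokhodSpace) : ℝ≥0∞ :=
  ∑' k : ℕ, 2⁻¹ ^ (k + 1) *
    min 1 (skorokhodDistOn ((k + 1 : ℕ) : ℝ≥0)
      (fun t => cutoff (k + 1) t * x.1 t) (fun t => cutoff (k + 1) t * y.1 t))

/-! ### The truncated random energy model

Throughout, `γ : Cube n → ℝ` is a realization of the Gaussian environment and `u` is the
truncation level. -/

/-- The cube `{-1,1}^n`. The graph distance `½ ∑ |x i - y i|` is `hammingDist x y`. -/
abbrev Cube (n : ℕ) : Type := Fin n → ℤˣ

instance instMeasurableSingletonClassSign : MeasurableSingletonClass ℤˣ :=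
  ⟨fun x => ⟨{(x : ℤ)}, measurableSet_singleton _, by ext y; simp [Units.ext_iff]⟩⟩

variable {n : ℕ}

/-- Boltzmann weight `exp (-β √n γ x)` of the random energy model without truncation. -/
def boltzmann (β : ℝ) (γ : Cube n → ℝ) (x : Cube n) : ℝ :=
  Real.exp (-β * (√(n : ℝ) * γ x))

open Classical in
/-- The truncated Hamiltonian. -/
def hamiltonian (u : ℝ) (γ : Cube n → ℝ) (x : Cube n) : ℝ :=
  if γ x ≤ -u then √(n : ℝ) * γ x else 0

open Classical in
/-- The occupied vertices. -/
def occupied (u : ℝ) (γ : Cube n → ℝ) : Finset (Cube n) :=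
  Finset.univ.filter fun x => γ x ≤ -u

open Classical in
/-- The isolated occupied vertices. -/
def isolated (u : ℝ) (γ : Cube n → ℝ) : Finset (Cube n) :=
  (occupied u γ).filter fun x => ∀ y, hammingDist x y = 1 → y ∉ occupied u γ

/-- The occupied vertices that are not isolated, i.e. the union of the connected components of
size at least two of the graph of occupied vertices. -/
def clusters (u : ℝ) (γ : Cube n → ℝ) : Finset (Cube n) :=
  occupied u γ \ isolated u γ

/-- The complement of the clusters. -/
def front (u : ℝ) (γ : Cube n → ℝ) : Finset (Cube n) :=
  Finset.univ \ clusters u γ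

/-! ### Metropolis dynamics -/

/-- The factor `exp (-β [H y - H x]⁺)` on the edges of the cube, and `0` elsewhere. -/
def metropolisWeight (β u : ℝ) (γ : Cube n → ℝ) (x y : Cube n) : ℝ :=
  if hammingDist x y = 1 then
    Real.exp (-β * max (hamiltonian u γ y - hamiltonian u γ x) 0) else 0

/-- The holding time parameter `(1/n) ∑_y exp (-β [H y - H x]⁺)`. -/
def holdingRate (β u : ℝ) (γ : Cube n → ℝ) (x : Cube n) : ℝ :=
  (1 / (n : ℝ)) * ∑ y, metropolisWeight β u γ x y

/-- The one-step law of the jump chain from `x`: proportional to `metropolisWeight β u γ x`. Only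
for `n = 0`, where `x` has no neighbour, is the weight identically zero, and then the chain
stays at `x`. -/
def jumpLaw (β u : ℝ) (γ : Cube n → ℝ) (x : Cube n) : PMF (Cube n) :=
  open Classical in
  if h : ∑' y, ENNReal.ofReal (metropolisWeight β u γ x y) ≠ 0 then
    PMF.normalize (fun y => ENNReal.ofReal (metropolisWeight β u γ x y)) h
      (by rw [tsum_fintype]; exact ENNReal.sum_ne_top.mpr fun _ _ => ENNReal.ofReal_ne_top)
  else PMF.pure x

/-- The transition kernel of the jump chain. -/
def jumpKernel (β u : ℝ) (γ : Cube n → ℝ) : Kernel (Cube n) (Cube n) :=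
  Kernel.ofFunOfCountable fun x => (jumpLaw β u γ x).toMeasure

instance instIsMarkovKernelJumpKernel (β u : ℝ) (γ : Cube n → ℝ) : IsMarkovKernel (jumpKernel β u γ) :=
  ⟨fun x => inferInstanceAs (IsProbabilityMeasure (jumpLaw β u γ x).toMeasure)⟩

/-- The law on path space of the jump chain started from the uniform distribution on
`front u γ`. -/
def jumpChainLaw (β u : ℝ) (γ : Cube n → ℝ) : Measure (ℕ → Cube n) :=
  Kernel.trajMeasure (X := fun _ => Cube n) (uniformOn (front u γ : Set (Cube n)))
    (fun k => (jumpKernel β u γ).comap (fun h : (i : Finset.Iic k) → Cube n =>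
      h ⟨k, Finset.mem_Iic.mpr le_rfl⟩) (measurable_pi_apply _))

/-- For a fixed environment, the joint law of the jump chain and of an independent sequence of
independent mean one exponential variables. -/
def dynamicsLaw (β u : ℝ) (γ : Cube n → ℝ) : Measure ((ℕ → Cube n) × (ℕ → ℝ)) :=
  (jumpChainLaw β u γ).prod (Measure.infinitePi fun _ => expMeasure 1)

/-! ### Clock processes

In what follows `J` is a trajectory of the jump chain and `e` a sequence of exponential
variables. -/

/-- `∑_{i < k} λ(J i)⁻¹ e i`. -/
def clock (β u : ℝ) (γ : Cube n → ℝ) (J : ℕ → Cube n) (e : ℕ → ℝ) (k : ℕ) : ℝ :=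
  ∑ i ∈ Finset.range k, (holdingRate β u γ (J i))⁻¹ * e i

/-- The least number of steps in which `J` makes `m` visits to `front u γ`
(in particular `0` if `m = 0`). -/
def stepsFor (u : ℝ) (γ : Cube n → ℝ) (J : ℕ → Cube n) (m : ℕ) : ℕ :=
  sInf {k | Nat.count (fun i => J i ∈ front u γ) k = m}

/-- The rescaled clock process. -/
def rescaledClock (β u a c : ℝ) (γ : Cube n → ℝ) (η : (ℕ → Cube n) × (ℕ → ℝ)) :
    SkorokhodSpace :=
  ⟨fun t => c⁻¹ * clock β u γ η.1 η.2 (stepsFor u γ η.1 ⌊a * (t : ℝ)⌋₊),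
    isCadlag_floor a fun m => c⁻¹ * clock β u γ η.1 η.2 (stepsFor u γ η.1 m)⟩

/-- The times `T 0 < T 1 < …` of the consecutive visits of `J` to `front u γ`. -/
def frontTime (u : ℝ) (γ : Cube n → ℝ) (J : ℕ → Cube n) (j : ℕ) : ℕ :=
  Nat.nth (fun i => J i ∈ front u γ) j

/-- The rescaled front end clock process: the clock of the chain `j ↦ J (T j)`, whose `j`-th step
uses the exponential variable `e (T j)` of the corresponding step of `J`, so that it records the
time spent in `front u γ`. -/
def rescaledFrontClock (β u a c : ℝ) (γ : Cube n → ℝ) (η : (ℕ → Cube n) × (ℕ → ℝ)) :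
    SkorokhodSpace :=
  ⟨fun t => c⁻¹ * clock β u γ (fun j => η.1 (frontTime u γ η.1 j))
      (fun j => η.2 (frontTime u γ η.1 j)) ⌊a * (t : ℝ)⌋₊,
    isCadlag_floor a fun m => c⁻¹ * clock β u γ (fun j => η.1 (frontTime u γ η.1 j))
      (fun j => η.2 (frontTime u γ η.1 j)) m⟩

/-- The rescaled time spent in the clusters along the first `stepsFor u γ J ⌊a t⌋` steps. -/
def clusterTime (β u a c : ℝ) (γ : Cube n → ℝ) (η : (ℕ → Cube n) × (ℕ → ℝ)) (t : ℝ≥0) : ℝ :=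
  c⁻¹ * ∑ i ∈ Finset.range (stepsFor u γ η.1 ⌊a * (t : ℝ)⌋₊),
    if η.1 i ∈ clusters u γ then (holdingRate β u γ (η.1 i))⁻¹ * η.2 i else 0

/-- The critical inverse temperature. -/
def betaC (ε : ℝ) : ℝ := √(ε * 2 * Real.log 2)

end TruncatedREM

end

open TruncatedREM

/-! With `u ≥ 0` the truncated Hamiltonian is nonpositive, and the jump chain is reversible for `exp
(-β H x) * λ x`, the sum of the edge conductances `exp (-β max (H x) (H y))` at `x` divided by `n`.
An edge with an unoccupied endpoint has conductance one, so this measure is constant on the front.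
Divided by the number of front vertices it becomes an invariant measure `q` that dominates the
uniform initial law. For such a `q`, the expected number of visits to `y` between consecutive visits
to the front is at most `q y`, so before the `m`-th front visit it is at most `m * q y`
(`tsum_chainLaw_visits_lt_le`). Neither mixing nor spectral information is needed.

The clusters containing a vertex of weight at least `c` are simply not entered. Every edge into such
a cluster from outside has conductance one, so the entrance probability is at most `m` times the
number of their vertices over the size of the front (`sum_flow_le`), whatever their depth. In the
other clusters the expected time spent at `x` is at most `m` times the Boltzmann weight of `x` over
the size of the front, up to the mean of an exponential variable, and Markov's inequality applies
(`measure_lt_weightedTime_le`).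

Both bounds are averaged over the environment. A cluster needs an additional occupied vertex next to
the one considered, which costs a factor `n * n ^ (-cstar)`. Vertices of heavy clusters are counted
by self-avoiding occupied walks from a heavy vertex, a geometric series. For light vertices, `β >
betaC ε` makes `a / c` times the expected weight below `c` bounded
(`exists_truncated_moment_bound`). Hence the expectation of `environmentError` is `O(n ^ (1 -
cstar))`, which is summable since `cstar > 2`, and the error tends to zero almost surely whatever
the joint law over `n`.

Finally the clock minus the front end clock is exactly the time spent in clusters, because the chain
visits the front infinitely often. With the identity as time change, smallness of that time on `[0,
M]` gives closeness in the Skorokhod metric. -/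

noncomputable section

namespace TruncatedREM

/-! ### Occupation and entrance bounds for finite Markov chains -/

section Paths

variable {E : Type*}

/-- A set of paths that is determined by the path up to time `k`. -/
def IsDeterminedUpTo (k : ℕ) (A : Set (ℕ → E)) : Prop :=
  ∀ J J' : ℕ → E, (∀ i ≤ k, J i = J' i) → J ∈ A → J' ∈ A

theorem IsDeterminedUpTo.eq_preimage {k : ℕ} {A : Set (ℕ → E)} (hA : IsDeterminedUpTo k A) :
    A = Preorder.frestrictLe (π := fun _ => E) k ⁻¹'
      (image (Preorder.frestrictLe (π := fun _ => E) k) A) := by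
  refine (subset_preimage_image _ _).antisymm ?_
  rintro J ⟨J', hJ', h⟩
  exact hA J' J (fun i hi => congrFun h ⟨i, Finset.mem_Iic.mpr hi⟩) hJ'

variable [DecidableEq E] (F : Finset E)

/-- The number of visits of `J` to `F` before time `k`. -/
abbrev visits (J : ℕ → E) (k : ℕ) : ℕ := Nat.count (fun i => J i ∈ F) k

theorem visits_congr {J J' : ℕ → E} {k : ℕ} (h : ∀ i < k, J i = J' i) :
    visits F J k = visits F J' k := by
  induction k with
  | zero => simp [visits]
  | succ k ih =>
    simp only [visits, Nat.count_succ, h k (Nat.lt_succ_self k)] at ih ⊢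
    rw [ih fun i hi => h i (hi.trans (Nat.lt_succ_self k))]

theorem isDeterminedUpTo_visits (p : ℕ → Prop) (k : ℕ) :
    IsDeterminedUpTo k {J : ℕ → E | p (visits F J k)} := by
  intro J J' h hJ
  rwa [mem_ofPred_eq, ← visits_congr F fun i hi => h i hi.le]

theorem isDeterminedUpTo_visits_and_mem (p : ℕ → Prop) (k : ℕ) (D : Set E) :
    IsDeterminedUpTo k {J : ℕ → E | p (visits F J k) ∧ J k ∈ D} := by
  intro J J' h hJ
  exact ⟨isDeterminedUpTo_visits F p k J J' h hJ.1, h k le_rfl ▸ hJ.2⟩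

end Paths

/-! ### Path-space law and the one-step Markov property. -/

section MarkovChain

variable {E : Type*} [MeasurableSpace E]

/-- The law on path space of the Markov chain with initial law `μ₀` and transition kernel `κ`. -/
def chainLaw (μ₀ : Measure E) (κ : Kernel E E) [IsMarkovKernel κ] : Measure (ℕ → E) :=
  Kernel.trajMeasure (X := fun _ => E) μ₀
    (fun k => κ.comap (fun h : (i : Finset.Iic k) → E =>
      h ⟨k, Finset.mem_Iic.mpr le_rfl⟩) (measurable_pi_apply _))

variable (μ₀ : Measure E) (κ : Kernel E E) [IsMarkovKernel κ]

instance instIsProbabilityMeasureChainLaw [IsProbabilityMeasure μ₀] :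
    IsProbabilityMeasure (chainLaw μ₀ κ) := by
  unfold chainLaw; infer_instance

theorem chainLaw_map_zero : (chainLaw μ₀ κ).map (fun J => J 0) = μ₀ := by
  have h1 : (fun J : ℕ → E => J 0) =
      (MeasurableEquiv.piUnique (fun _ : Finset.Iic 0 => E)) ∘
        (Preorder.frestrictLe (π := fun _ => E) 0) := by
    funext J; rfl
  rw [h1, ← Measure.map_map (by fun_prop) (by fun_prop), chainLaw, Kernel.trajMeasure,
    Measure.map_comp _ _ (by fun_prop), Kernel.traj_map_frestrictLe, Kernel.partialTraj_self,
    Measure.id_comp, Measure.map_map (by fun_prop) (by fun_prop),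
    MeasurableEquiv.self_comp_symm, Measure.map_id]

variable [IsProbabilityMeasure μ₀] [Countable E] [MeasurableSingletonClass E]

theorem IsDeterminedUpTo.measurableSet {k : ℕ} {A : Set (ℕ → E)} (hA : IsDeterminedUpTo k A) :
    MeasurableSet A := by
  rw [hA.eq_preimage]
  exact Preorder.measurable_frestrictLe k (Set.to_countable _).measurableSet

/-- Markov property at a fixed time: `A` is a cylinder over the first `k + 1` coordinates, and the
joint law of these with the next state is a composition product whose kernel depends only on the
state at time `k`. -/
theorem chainLaw_step {k : ℕ} {A : Set (ℕ → E)} (hA : IsDeterminedUpTo k A) (x y : E) :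
    chainLaw μ₀ κ {J | J ∈ A ∧ J k = x ∧ J (k + 1) = y} =
      chainLaw μ₀ κ {J | J ∈ A ∧ J k = x} * κ x {y} := by
  set S : Set (Finset.Iic k → E) :=
    (image (Preorder.frestrictLe (π := fun _ => E) k) A) ∩ {h | h ⟨k, Finset.mem_Iic.mpr le_rfl⟩ = x}
  have hS : MeasurableSet S := (Set.to_countable _).measurableSet
  have hr : Measurable (Preorder.frestrictLe (π := fun _ => E) k) :=
    Preorder.measurable_frestrictLe k
  have h1 : {J : ℕ → E | J ∈ A ∧ J k = x} = Preorder.frestrictLe (π := fun _ => E) k ⁻¹' S := by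
    conv_lhs => rw [hA.eq_preimage]
    rfl
  have h2 : {J : ℕ → E | J ∈ A ∧ J k = x ∧ J (k + 1) = y} =
      (fun J => (Preorder.frestrictLe (π := fun _ => E) k J, J (k + 1))) ⁻¹' (S ×ˢ {y}) := by
    conv_lhs => rw [hA.eq_preimage]
    ext J
    simp [S, and_assoc]
  have key := Kernel.map_frestrictLe_trajMeasure_compProd_eq_map_trajMeasure
    (X := fun _ => E) (μ₀ := μ₀)
    (κ := fun k => κ.comap (fun h : (i : Finset.Iic k) → E =>
      h ⟨k, Finset.mem_Iic.mpr le_rfl⟩) (measurable_pi_apply _)) (a := k)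
  rw [h2, ← Measure.map_apply (by fun_prop) (hS.prod (measurableSet_singleton y))]
  change (Measure.map _ (Kernel.trajMeasure _ _)) _ = _
  rw [← key, Measure.compProd_apply_prod hS (measurableSet_singleton y), h1,
    ← Measure.map_apply hr hS]
  rw [setLIntegral_congr_fun hS (g := fun _ => κ x {y}), lintegral_const,
    Measure.restrict_apply_univ, mul_comm]
  · rfl
  · intro h hh
    have : h ⟨k, Finset.mem_Iic.mpr le_rfl⟩ = x := hh.2
    simp [Kernel.comap_apply, this]

end MarkovChain

/-! ### Occupation bounds from a dominating excessive measure `q`. -/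

section Occupation

variable {E : Type*} [MeasurableSpace E] [Fintype E] [DecidableEq E] [MeasurableSingletonClass E]
  (μ₀ : Measure E) [IsProbabilityMeasure μ₀] (κ : Kernel E E) [IsMarkovKernel κ]
  (F : Finset E)

variable {F} {μ₀ κ} {q : E → ℝ≥0∞}

/-- Induction on the horizon `N`, for all `j` and `y` at once. A visit at a positive time is reached
by one step from a visit to some `x` with the count at `j` or one lower, and `q` is excessive. The
initial law never has to be added to this flow: starting in `F`, the count is zero only at time
zero, so the initial term is the whole sum for `j = 0` and is absent for `j > 0`. -/
theorem sum_chainLaw_visits_eq_le (hq : ∀ y, ∑ x, q x * κ x {y} ≤ q y)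
    (hμ : ∀ x, μ₀ {x} ≤ q x) (hF : ∀ x ∉ F, μ₀ {x} = 0) (N j : ℕ) (y : E) :
    ∑ i ∈ Finset.range N, chainLaw μ₀ κ {J | visits F J i = j ∧ J i = y} ≤ q y := by
  have h0 : ∀ y, chainLaw μ₀ κ {J | J 0 = y} = μ₀ {y} := fun y => by
    conv_rhs => rw [← chainLaw_map_zero μ₀ κ,
      Measure.map_apply (measurable_pi_apply 0) (measurableSet_singleton y)]
    rfl
  have hstep : ∀ i j y, chainLaw μ₀ κ {J | visits F J (i + 1) = j ∧ J (i + 1) = y} ≤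
      ∑ x, chainLaw μ₀ κ {J | visits F J i + (if x ∈ F then 1 else 0) = j ∧ J i = x} *
        κ x {y} := by
    intro i j y
    calc _ ≤ chainLaw μ₀ κ (⋃ x ∈ (Finset.univ : Finset E),
            {J | J ∈ {J | visits F J i + (if x ∈ F then 1 else 0) = j} ∧ J i = x ∧
              J (i + 1) = y}) := by
          refine measure_mono fun J hJ => ?_
          simp only [mem_iUnion, Finset.mem_univ, exists_true_left]
          refine ⟨J i, ?_, rfl, hJ.2⟩
          have := hJ.1
          rw [visits, Nat.count_succ] at this
          exact this
      _ ≤ _ := (measure_biUnion_finset_le _ _).trans (Finset.sum_le_sum fun x _ =>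
          (chainLaw_step μ₀ κ (isDeterminedUpTo_visits F (fun v => v + _ = j) i) x y).le)
  have hzero : ∀ i y, chainLaw μ₀ κ {J | visits F J (i + 1) = 0 ∧ J (i + 1) = y} = 0 := by
    intro i y
    refine measure_mono_null (t := ⋃ x ∈ (Fᶜ : Finset E), {J | J 0 = x}) (fun J hJ => ?_) ?_
    · simp only [mem_iUnion]
      refine ⟨J 0, ?_, rfl⟩
      simp only [Finset.mem_compl]
      intro hmem
      have : visits F J 1 ≤ visits F J (i + 1) := Nat.count_monotone _ (by omega)
      rw [hJ.1] at this
      simp [visits, Nat.count_succ, hmem] at this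
    · refine (measure_biUnion_null_iff (Finset.countable_toSet Fᶜ)).mpr fun x hx => ?_
      rw [h0, hF x (by simpa using hx)]
  induction N generalizing j y with
  | zero => simp
  | succ N ih =>
    rw [Finset.sum_range_succ']
    rcases j with _ | j
    · simp only [hzero, Finset.sum_const_zero, zero_add]
      refine (measure_mono fun J hJ => ?_).trans ((h0 y).le.trans (hμ y))
      exact hJ.2
    · have h1 : chainLaw μ₀ κ {J | visits F J 0 = j + 1 ∧ J 0 = y} = 0 := by
        simp [visits]
      rw [h1, add_zero]
      calc _ ≤ ∑ i ∈ Finset.range N, ∑ x,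
            chainLaw μ₀ κ {J | visits F J i + (if x ∈ F then 1 else 0) = j + 1 ∧ J i = x} *
              κ x {y} := Finset.sum_le_sum fun i _ => hstep i _ y
        _ = ∑ x, (∑ i ∈ Finset.range N,
            chainLaw μ₀ κ {J | visits F J i + (if x ∈ F then 1 else 0) = j + 1 ∧ J i = x}) *
              κ x {y} := by
            rw [Finset.sum_comm]
            simp_rw [Finset.sum_mul]
        _ ≤ ∑ x, q x * κ x {y} := by
            refine Finset.sum_le_sum fun x _ => ?_
            gcongr
            split_ifs
            · simpa using ih j x
            · simpa using ih (j + 1) x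
        _ ≤ q y := hq y

theorem tsum_chainLaw_visits_lt_le (hq : ∀ y, ∑ x, q x * κ x {y} ≤ q y)
    (hμ : ∀ x, μ₀ {x} ≤ q x) (hF : ∀ x ∉ F, μ₀ {x} = 0) (m : ℕ) (y : E) :
    ∑' i, chainLaw μ₀ κ {J | visits F J i < m ∧ J i = y} ≤ m * q y := by
  refine ENNReal.tsum_le_of_sum_range_le fun N => ?_
  calc _ ≤ ∑ i ∈ Finset.range N, ∑ j ∈ Finset.range m,
        chainLaw μ₀ κ {J | visits F J i = j ∧ J i = y} := by
        refine Finset.sum_le_sum fun i _ => ?_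
        refine (measure_mono fun J hJ => ?_).trans (measure_biUnion_finset_le _ _)
        simp only [mem_iUnion]
        exact ⟨visits F J i, Finset.mem_range.mpr hJ.1, rfl, hJ.2⟩
    _ = ∑ j ∈ Finset.range m, ∑ i ∈ Finset.range N,
        chainLaw μ₀ κ {J | visits F J i = j ∧ J i = y} := Finset.sum_comm
    _ ≤ ∑ j ∈ Finset.range m, q y :=
        Finset.sum_le_sum fun j _ => sum_chainLaw_visits_eq_le hq hμ hF N j y
    _ = m * q y := by simp

/-- The probability that the chain enters `B` before its `m`-th visit to `F` is at most `m` times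
the flow of `q` into `B`. -/
theorem chainLaw_exists_mem_le (hq : ∀ y, ∑ x, q x * κ x {y} ≤ q y)
    (hμ : ∀ x, μ₀ {x} ≤ q x) (hF : ∀ x ∉ F, μ₀ {x} = 0) (m : ℕ) (B : Finset E)
    (hB : Disjoint B F) :
    chainLaw μ₀ κ {J | ∃ i, visits F J i < m ∧ J i ∈ B} ≤
      m * ∑ x ∈ Bᶜ, ∑ z ∈ B, q x * κ x {z} := by
  have h0 : chainLaw μ₀ κ {J | J 0 ∈ B} = 0 := by
    have : chainLaw μ₀ κ {J | J 0 ∈ B} = μ₀ B := by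
      conv_rhs => rw [← chainLaw_map_zero μ₀ κ,
        Measure.map_apply (measurable_pi_apply 0) B.measurableSet]
      rfl
    rw [this, ← sum_measure_singleton]
    exact Finset.sum_eq_zero fun x hx => hF x (Finset.disjoint_left.mp hB hx)
  calc _ ≤ chainLaw μ₀ κ ({J | J 0 ∈ B} ∪ ⋃ i, ⋃ x ∈ Bᶜ, ⋃ z ∈ B,
        {J | J ∈ {J | visits F J i < m} ∧ J i = x ∧ J (i + 1) = z}) := by
        refine measure_mono fun J hJ => ?_
        -- The first time in `B` is not zero, except on a null event, as the chain starts in `F`. So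
        -- it is the end of a step from the complement of `B`, taken before the `m`-th visit to `F`.
        have hex : ∃ i, J i ∈ B := hJ.imp fun i hi => hi.2
        obtain ⟨i, hi, hiB⟩ := hJ
        have hfind : Nat.find hex ≤ i := Nat.find_min' hex hiB
        rcases h : Nat.find hex with _ | k
        · left
          have := Nat.find_spec hex
          rwa [h] at this
        · right
          simp only [mem_iUnion]
          have h1 := Nat.find_spec hex
          rw [h] at h1
          have h2 : J k ∉ B := Nat.find_min hex (by omega)
          refine ⟨k, J k, Finset.mem_compl.mpr h2, J (k + 1), h1, ?_, rfl, rfl⟩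
          exact (Nat.count_monotone _ (by omega : k ≤ i)).trans_lt hi
    _ ≤ ∑' i, ∑ x ∈ Bᶜ, ∑ z ∈ B, chainLaw μ₀ κ {J | visits F J i < m ∧ J i = x} * κ x {z} := by
        refine (measure_union_le _ _).trans ?_
        rw [h0, zero_add]
        refine (measure_iUnion_le _).trans (ENNReal.tsum_le_tsum fun i => ?_)
        refine (measure_biUnion_finset_le _ _).trans (Finset.sum_le_sum fun x _ => ?_)
        refine (measure_biUnion_finset_le _ _).trans (Finset.sum_le_sum fun z _ => ?_)
        exact (chainLaw_step μ₀ κ (isDeterminedUpTo_visits F (fun v => v < m) i) x z).le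
    _ = ∑ x ∈ Bᶜ, ∑ z ∈ B,
          (∑' i, chainLaw μ₀ κ {J | visits F J i < m ∧ J i = x}) * κ x {z} := by
        rw [Summable.tsum_finsetSum fun _ _ => ENNReal.summable]
        refine Finset.sum_congr rfl fun x _ => ?_
        rw [Summable.tsum_finsetSum fun _ _ => ENNReal.summable]
        exact Finset.sum_congr rfl fun z _ => ENNReal.tsum_mul_right
    _ ≤ ∑ x ∈ Bᶜ, ∑ z ∈ B, (m * q x) * κ x {z} := by
        gcongr with x _ z _
        exact tsum_chainLaw_visits_lt_le hq hμ hF m x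
    _ = _ := by simp_rw [Finset.mul_sum, mul_assoc]

/-- The expected `φ`-weighted occupation of the chain before its `m`-th visit to `F`. -/
theorem lintegral_occupation_le (hq : ∀ y, ∑ x, q x * κ x {y} ≤ q y)
    (hμ : ∀ x, μ₀ {x} ≤ q x) (hF : ∀ x ∉ F, μ₀ {x} = 0) (m : ℕ) (D : Finset E)
    (φ : E → ℝ≥0∞) :
    ∑' i, ∫⁻ J, {J | visits F J i < m ∧ J i ∈ (D : Set E)}.indicator (fun J => φ (J i)) J
      ∂(chainLaw μ₀ κ) ≤ m * ∑ x ∈ D, q x * φ x := by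
  have h1 : ∀ i, ∫⁻ J, {J | visits F J i < m ∧ J i ∈ (D : Set E)}.indicator
      (fun J => φ (J i)) J ∂(chainLaw μ₀ κ) =
      ∑ x ∈ D, φ x * chainLaw μ₀ κ {J | visits F J i < m ∧ J i = x} := by
    intro i
    have hm : ∀ x, MeasurableSet {J : ℕ → E | visits F J i < m ∧ J i = x} := fun x =>
      (isDeterminedUpTo_visits_and_mem F (fun v => v < m) i {x}).measurableSet
    have : ∀ J : ℕ → E, {J | visits F J i < m ∧ J i ∈ (D : Set E)}.indicator
        (fun J => φ (J i)) J =
        ∑ x ∈ D, {J | visits F J i < m ∧ J i = x}.indicator (fun _ => φ x) J := by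
      intro J
      by_cases hv : visits F J i < m
      · by_cases hD : J i ∈ D
        · rw [Finset.sum_eq_single_of_mem (J i) hD]
          · simp [indicator, hv, hD]
          · intro x _ hx
            simp [indicator, hx.symm]
        · rw [Finset.sum_eq_zero]
          · simp [indicator, hD]
          · intro x hx
            have : J i ≠ x := fun h => hD (h ▸ hx)
            simp [indicator, this]
      · simp [indicator, hv]
    simp_rw [this]
    rw [lintegral_finsetSum _ fun x _ => measurable_const.indicator (hm x)]
    exact Finset.sum_congr rfl fun x _ => lintegral_indicator_const (hm x) _
  simp_rw [h1]
  rw [Summable.tsum_finsetSum fun _ _ => ENNReal.summable, Finset.mul_sum]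
  refine Finset.sum_le_sum fun x _ => ?_
  rw [ENNReal.tsum_mul_left]
  calc _ ≤ φ x * (m * q x) := by gcongr; exact tsum_chainLaw_visits_lt_le hq hμ hF m x
    _ = _ := by ring

/-- A path with finitely many visits to `F` would stay forever in the complement with a bounded
count, whereas the expected occupation of the complement before the `m`-th visit is at most `m`
times its finite `q`-mass. Irreducibility is not used. -/
theorem ae_infinite_visits (hq : ∀ y, ∑ x, q x * κ x {y} ≤ q y)
    (hμ : ∀ x, μ₀ {x} ≤ q x) (hF : ∀ x ∉ F, μ₀ {x} = 0) (hfin : ∀ x, q x ≠ ∞) :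
    ∀ᵐ J ∂(chainLaw μ₀ κ), {i | J i ∈ F}.Infinite := by
  have hm : ∀ m i, MeasurableSet {J : ℕ → E | visits F J i < m ∧ J i ∈ ((Fᶜ : Finset E) : Set E)} :=
    fun m i => (isDeterminedUpTo_visits_and_mem F (fun v => v < m) i _).measurableSet
  have h1 : ∀ᵐ J ∂(chainLaw μ₀ κ), ∀ m : ℕ, ∑' i,
      {J : ℕ → E | visits F J i < m ∧ J i ∈ ((Fᶜ : Finset E) : Set E)}.indicator
        (fun _ => (1 : ℝ≥0∞)) J ≠ ∞ := by
    rw [ae_all_iff]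
    intro m
    have hle := lintegral_occupation_le hq hμ hF m Fᶜ (fun _ => 1)
    rw [← lintegral_tsum fun i => (measurable_const.indicator (hm m i)).aemeasurable] at hle
    refine (ae_lt_top (Measurable.tsum fun i => measurable_const.indicator (hm m i))
      (ne_top_of_le_ne_top ?_ hle)).mono fun J hJ => hJ.ne
    refine ENNReal.mul_ne_top (by simp) (ENNReal.sum_ne_top.mpr fun x _ => ?_)
    simpa using hfin x
  filter_upwards [h1] with J hJ hfinite
  obtain ⟨N, hN⟩ := hfinite.bddAbove
  have hv : ∀ i, visits F J i ≤ N + 1 := by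
    intro i
    rcases le_total i (N + 1) with h | h
    · exact (Nat.count_le _).trans h
    · have : visits F J i = visits F J (N + 1) := by
        obtain ⟨k, rfl⟩ := Nat.exists_eq_add_of_le h
        rw [visits, Nat.count_add, Nat.add_eq_left, Nat.count_iff_forall_not]
        intro j _ hj
        have := hN hj
        omega
      rw [this]
      exact Nat.count_le _
  -- If all visits to `F` occur at times at most `N`, the count never exceeds `N + 1`, so every
  -- later time contributes to the occupation sum with `m = N + 2`.
  refine hJ (N + 2) ?_
  rw [eq_top_iff]
  calc ∞ = ∑' i : ℕ, (1 : ℝ≥0∞) := by simp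
    _ = ∑' i : ℕ, {J : ℕ → E | visits F J (i + (N + 1)) < N + 2 ∧
          J (i + (N + 1)) ∈ ((Fᶜ : Finset E) : Set E)}.indicator (fun _ => (1 : ℝ≥0∞)) J := by
        refine tsum_congr fun i => ?_
        rw [indicator_of_mem]
        refine ⟨(hv _).trans_lt (by omega), ?_⟩
        simp only [Finset.coe_compl, mem_compl_iff, Finset.mem_coe]
        intro h
        have := hN h
        omega
    _ ≤ _ := ENNReal.tsum_comp_le_tsum_of_injective (add_left_injective (N + 1)) _

end Occupation

/-! ### Weighted occupation times with exponential holding times -/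

theorem lintegral_abs_expMeasure_lt_top :
    ∫⁻ x, ENNReal.ofReal |x| ∂(expMeasure 1) < ∞ := by
  have h1 : expMeasure 1 = volume.withDensity (exponentialPDF 1) := rfl
  have hm : Measurable (exponentialPDF 1) := (measurable_exponentialPDFReal 1).ennreal_ofReal
  rw [h1, lintegral_withDensity_eq_lintegral_mul _ hm (by fun_prop)]
  -- The integrand of `Γ(2)`. Only finiteness of the mean matters: it enters the bounds as a
  -- constant factor.
  have hintegrable : IntegrableOn (fun x : ℝ => Real.exp (-x) * x ^ ((2 : ℝ) - 1)) (Ioi 0) :=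
    Real.GammaIntegral_convergent two_pos
  have hle : ∀ x, (exponentialPDF 1 * fun x => ENNReal.ofReal |x|) x ≤
      (Ioi (0 : ℝ)).indicator
        (fun x => ENNReal.ofReal (Real.exp (-x) * x ^ ((2 : ℝ) - 1))) x := by
    intro x
    rcases lt_trichotomy x 0 with hx | rfl | hx
    · simp [exponentialPDF_of_neg hx]
    · simp
    · rw [indicator_of_mem (mem_Ioi.mpr hx), Pi.mul_apply, exponentialPDF_of_nonneg hx.le,
        ← ENNReal.ofReal_mul (by positivity), abs_of_pos hx]
      norm_num
  refine (lintegral_mono hle).trans_lt ?_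
  rw [lintegral_indicator measurableSet_Ioi]
  exact hintegrable.lintegral_lt_top

section WeightedTime

variable {E : Type*} [DecidableEq E]

/-- The `φ`-weighted time spent in `D` before the `m`-th visit to `F`, where the `i`-th step
lasts `|e i|`. -/
def weightedTime (F D : Finset E) (φ : E → ℝ≥0∞) (m : ℕ) (η : (ℕ → E) × (ℕ → ℝ)) : ℝ≥0∞ :=
  ∑' i, {J : ℕ → E | visits F J i < m ∧ J i ∈ (D : Set E)}.indicator (fun J => φ (J i)) η.1 *
    ENNReal.ofReal |η.2 i|

theorem weightedTime_mono_index {F D : Finset E} {φ : E → ℝ≥0∞} {m m' : ℕ} (h : m ≤ m')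
    (η : (ℕ → E) × (ℕ → ℝ)) : weightedTime F D φ m η ≤ weightedTime F D φ m' η := by
  refine ENNReal.tsum_le_tsum fun i => mul_le_mul_left ?_ _
  refine indicator_le_indicator_of_subset (fun J hJ => ?_) (fun _ => zero_le) _
  exact ⟨hJ.1.trans_le h, hJ.2⟩


variable [MeasurableSpace E] [Fintype E] [MeasurableSingletonClass E]

theorem measurable_indicator_visits (F D : Finset E) (φ : E → ℝ≥0∞) (m i : ℕ) :
    Measurable
      ({J : ℕ → E | visits F J i < m ∧ J i ∈ (D : Set E)}.indicator (fun J => φ (J i))) :=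
  ((measurable_of_countable φ).comp (measurable_pi_apply i)).indicator
    (isDeterminedUpTo_visits_and_mem F (fun v => v < m) i _).measurableSet

theorem measurable_weightedTime (F D : Finset E) (φ : E → ℝ≥0∞) (m : ℕ) :
    Measurable (weightedTime F D φ m) := by
  refine Measurable.tsum fun i => ?_
  refine ((measurable_indicator_visits F D φ m i).comp measurable_fst).mul ?_
  fun_prop

variable {μ₀ : Measure E} [IsProbabilityMeasure μ₀] {κ : Kernel E E} [IsMarkovKernel κ]
  {F : Finset E} {q : E → ℝ≥0∞}

theorem lintegral_weightedTime_le (hq : ∀ y, ∑ x, q x * κ x {y} ≤ q y)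
    (hμ : ∀ x, μ₀ {x} ≤ q x) (hF : ∀ x ∉ F, μ₀ {x} = 0) (m : ℕ) (D : Finset E)
    (φ : E → ℝ≥0∞) :
    ∫⁻ η, weightedTime F D φ m η
        ∂((chainLaw μ₀ κ).prod (Measure.infinitePi fun _ => expMeasure 1)) ≤
      (m * ∑ x ∈ D, q x * φ x) * ∫⁻ x, ENNReal.ofReal |x| ∂(expMeasure 1) := by
  have : IsProbabilityMeasure (expMeasure 1) := isProbabilityMeasure_expMeasure one_pos
  have he : ∀ i, ∫⁻ e : ℕ → ℝ, ENNReal.ofReal |e i| ∂(Measure.infinitePi fun _ => expMeasure 1) =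
      ∫⁻ x, ENNReal.ofReal |x| ∂(expMeasure 1) := fun i =>
    (measurePreserving_eval_infinitePi (fun _ : ℕ => expMeasure 1) i).lintegral_comp
      (f := fun x => ENNReal.ofReal |x|) (by fun_prop)
  unfold weightedTime
  have hmeas : ∀ i, Measurable fun η : (ℕ → E) × (ℕ → ℝ) =>
      {J : ℕ → E | visits F J i < m ∧ J i ∈ (D : Set E)}.indicator (fun J => φ (J i)) η.1 *
        ENNReal.ofReal |η.2 i| := fun i =>
    ((measurable_indicator_visits F D φ m i).comp measurable_fst).mul (by fun_prop)
  rw [lintegral_tsum fun i => (hmeas i).aemeasurable]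
  have h1 : ∀ i, ∫⁻ η : (ℕ → E) × (ℕ → ℝ),
      {J : ℕ → E | visits F J i < m ∧ J i ∈ (D : Set E)}.indicator (fun J => φ (J i)) η.1 *
        ENNReal.ofReal |η.2 i|
      ∂((chainLaw μ₀ κ).prod (Measure.infinitePi fun _ => expMeasure 1)) =
      (∫⁻ J, {J : ℕ → E | visits F J i < m ∧ J i ∈ (D : Set E)}.indicator (fun J => φ (J i)) J
        ∂(chainLaw μ₀ κ)) * ∫⁻ x, ENNReal.ofReal |x| ∂(expMeasure 1) := by
    intro i
    rw [← he i]
    exact lintegral_prod_mul (g := fun e : ℕ → ℝ => ENNReal.ofReal |e i|)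
      (measurable_indicator_visits F D φ m i).aemeasurable
      (Measurable.aemeasurable (by fun_prop))
  simp_rw [h1]
  rw [ENNReal.tsum_mul_right]
  gcongr
  exact lintegral_occupation_le hq hμ hF m D φ

/-- Either the path enters `B` in time, which the flow into `B` controls, or all its time in `D` is
spent in `D \ B`, where Markov's inequality suffices. The weights `φ` on `B` therefore play no role.
-/
theorem measure_lt_weightedTime_le (hq : ∀ y, ∑ x, q x * κ x {y} ≤ q y)
    (hμ : ∀ x, μ₀ {x} ≤ q x) (hF : ∀ x ∉ F, μ₀ {x} = 0) (m : ℕ) (D B : Finset E)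
    (hB : Disjoint B F) (φ : E → ℝ≥0∞) {r : ℝ≥0∞} (hr0 : r ≠ 0) (hr : r ≠ ∞) :
    ((chainLaw μ₀ κ).prod (Measure.infinitePi fun _ => expMeasure 1))
        {η | r < weightedTime F D φ m η} ≤
      m * ∑ x ∈ Bᶜ, ∑ z ∈ B, q x * κ x {z} +
        (m * ∑ x ∈ D \ B, q x * φ x) * (∫⁻ x, ENNReal.ofReal |x| ∂(expMeasure 1)) / r := by
  have : IsProbabilityMeasure (expMeasure 1) := isProbabilityMeasure_expMeasure one_pos
  have hsub : {η : (ℕ → E) × (ℕ → ℝ) | r < weightedTime F D φ m η} ⊆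
      ({J | ∃ i, visits F J i < m ∧ J i ∈ B} ×ˢ univ) ∪
        {η | r ≤ weightedTime F (D \ B) φ m η} := by
    intro η hη
    by_cases hex : ∃ i, visits F η.1 i < m ∧ η.1 i ∈ B
    · exact Or.inl ⟨hex, mem_univ _⟩
    · right
      push Not at hex
      refine hη.le.trans (ENNReal.tsum_le_tsum fun i => ?_)
      refine mul_le_mul_left ?_ _
      by_cases h : η.1 ∈ {J : ℕ → E | visits F J i < m ∧ J i ∈ (D : Set E)}
      · have h' : η.1 ∈ {J : ℕ → E | visits F J i < m ∧ J i ∈ ((D \ B : Finset E) : Set E)} :=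
          ⟨h.1, by simpa using ⟨h.2, hex i h.1⟩⟩
        rw [indicator_of_mem h', indicator_of_mem h]
      · rw [indicator_of_notMem h]
        exact zero_le
  refine (measure_mono hsub).trans ((measure_union_le _ _).trans ?_)
  gcongr
  · rw [Measure.prod_prod, measure_univ, mul_one]
    exact chainLaw_exists_mem_le hq hμ hF m B hB
  · refine (meas_ge_le_lintegral_div (measurable_weightedTime F _ φ m).aemeasurable hr0 hr).trans ?_
    gcongr
    exact lintegral_weightedTime_le hq hμ hF m _ φ

end WeightedTime

/-! ### Comparison of paths in the Skorokhod metric -/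

theorem timeChangeNorm_refl (m : ℝ≥0) :
    timeChangeNorm (OrderIso.refl (Icc (0 : ℝ≥0) m)) = 0 := by
  simp only [timeChangeNorm, ENNReal.iSup_eq_zero, OrderIso.refl_apply]
  intro s t hst
  have h : ((t : ℝ≥0) : ℝ) - ((s : ℝ≥0) : ℝ) ≠ 0 :=
    sub_ne_zero.mpr (NNReal.coe_lt_coe.mpr hst).ne'
  simp [div_self h]

theorem skorokhodDistOn_le {m : ℝ≥0} {x y : ℝ≥0 → ℝ} {b : ℝ≥0∞}
    (h : ∀ t ≤ m, ENNReal.ofReal |x t - y t| ≤ b) : skorokhodDistOn m x y ≤ b := by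
  refine (iInf_le _ (OrderIso.refl _)).trans ?_
  rw [timeChangeNorm_refl]
  exact max_le (zero_le) (iSup_le fun t => h t t.2.2)

theorem abs_cutoff_mul_sub_le (m : ℕ) (t : ℝ≥0) (x y : ℝ) :
    |cutoff m t * x - cutoff m t * y| ≤ |x - y| := by
  have h0 : 0 ≤ cutoff m t := le_max_left _ _
  have h1 : cutoff m t ≤ 1 := max_le zero_le_one (min_le_left _ _)
  rw [← mul_sub, abs_mul, abs_of_nonneg h0]
  exact mul_le_of_le_one_left (abs_nonneg _) h1

theorem tsum_two_inv_pow_add (M : ℕ) : ∑' k : ℕ, (2⁻¹ : ℝ≥0∞) ^ (M + (k + 1)) = 2⁻¹ ^ M := by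
  simp_rw [pow_add, pow_one]
  rw [ENNReal.tsum_mul_left, ENNReal.tsum_mul_right, ENNReal.tsum_geometric,
    ENNReal.one_sub_inv_two, inv_inv, ENNReal.mul_inv_cancel (by simp) (by simp), mul_one]

/-- The first `M` terms only see `[0, M]`, where the identity time change gives `b`; the remaining
weights sum to `2⁻¹ ^ M`. -/
theorem skorokhodDist_le {x y : SkorokhodSpace} {M : ℕ} {b : ℝ≥0∞}
    (h : ∀ t : ℝ≥0, t ≤ M → ENNReal.ofReal |x.1 t - y.1 t| ≤ b) :
    skorokhodDist x y ≤ b + 2⁻¹ ^ M := by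
  set d : ℕ → ℝ≥0∞ := fun k => skorokhodDistOn ((k + 1 : ℕ) : ℝ≥0)
        (fun t => cutoff (k + 1) t * x.1 t) (fun t => cutoff (k + 1) t * y.1 t) with hd
  have hdk : ∀ k < M, d k ≤ b := by
    intro k hk
    refine skorokhodDistOn_le fun t ht => ?_
    refine (ENNReal.ofReal_le_ofReal (abs_cutoff_mul_sub_le _ _ _ _)).trans (h t (ht.trans ?_))
    exact Nat.cast_le.mpr hk
  have hgeom : ∑' k : ℕ, (2⁻¹ : ℝ≥0∞) ^ (k + 1) = 1 := by
    simpa using tsum_two_inv_pow_add 0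
  change ∑' k : ℕ, 2⁻¹ ^ (k + 1) * min 1 (d k) ≤ _
  clear_value d
  rw [← Summable.sum_add_tsum_nat_add' (k := M) ENNReal.summable]
  gcongr
  · calc ∑ k ∈ Finset.range M, 2⁻¹ ^ (k + 1) * min 1 (d k)
        ≤ ∑ k ∈ Finset.range M, 2⁻¹ ^ (k + 1) * b :=
          Finset.sum_le_sum fun k hk => by
            gcongr
            exact (min_le_right _ _).trans (hdk k (Finset.mem_range.mp hk))
      _ ≤ ∑' k : ℕ, 2⁻¹ ^ (k + 1) * b := ENNReal.sum_le_tsum _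
      _ = b := by rw [ENNReal.tsum_mul_right, hgeom, one_mul]
  · rw [← tsum_two_inv_pow_add M]
    refine ENNReal.tsum_le_tsum fun k => ?_
    rw [add_assoc, add_left_comm]
    exact mul_le_of_le_one_right' (min_le_left _ _)

/-! ### The clock processes along a path -/

theorem sum_filter_range_eq_sum_nth (p : ℕ → Prop) [DecidablePred p] (f : ℕ → ℝ) (k : ℕ) :
    ∑ i ∈ Finset.range k, (if p i then f i else 0) =
      ∑ j ∈ Finset.range (Nat.count p k), f (Nat.nth p j) := by
  induction k with
  | zero => simp
  | succ k ih =>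
    rw [Finset.sum_range_succ, ih, Nat.count_succ]
    split_ifs with h
    · rw [Finset.sum_range_succ, Nat.nth_count h]
    · simp

variable {n : ℕ} {u : ℝ} {γ : Cube n → ℝ}

/-- Discrete intermediate values: the count starts at zero and grows by at most one, so if it
reached `m` or more by time `i`, it would equal `m` at some time no later than `i`. -/
theorem visits_lt_of_lt_stepsFor {J : ℕ → Cube n} {m i : ℕ} (h : i < stepsFor u γ J m) :
    visits (front u γ) J i < m := by
  by_contra! hle
  have hex : ∃ k ≤ i, visits (front u γ) J k = m := by
    clear h
    induction i with
    | zero => exact ⟨0, le_rfl, by simp [visits] at hle ⊢; omega⟩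
    | succ i ih =>
      by_cases h1 : m ≤ visits (front u γ) J i
      · obtain ⟨k, hk, hkm⟩ := ih h1
        exact ⟨k, hk.trans (Nat.le_succ i), hkm⟩
      · refine ⟨i + 1, le_rfl, ?_⟩
        have : visits (front u γ) J (i + 1) ≤ visits (front u γ) J i + 1 := by
          simp only [visits, Nat.count_succ]; split_ifs <;> omega
        omega
  obtain ⟨k, hk, hkm⟩ := hex
  have : stepsFor u γ J m ≤ k := Nat.sInf_le hkm
  omega

/-- Infinitely many visits make the defining set nonempty; for an empty set `sInf` would return the
default value `0`. -/
theorem visits_stepsFor {J : ℕ → Cube n} (hJ : {i | J i ∈ front u γ}.Infinite) (m : ℕ) :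
    visits (front u γ) J (stepsFor u γ J m) = m :=
  Nat.sInf_mem (s := {k | Nat.count (fun i => J i ∈ front u γ) k = m})
    ⟨Nat.nth (fun i => J i ∈ front u γ) m, Nat.count_nth_of_infinite hJ m⟩

theorem mem_clusters_iff_notMem_front {x : Cube n} : x ∈ clusters u γ ↔ x ∉ front u γ := by
  simp [front]

variable {β a c : ℝ}

/-- The steps counted by the clock contain exactly the first `⌊a t⌋` front visits, and these use the
same exponential variables in both clocks, so they cancel. -/
theorem rescaledClock_sub_rescaledFrontClock {η : (ℕ → Cube n) × (ℕ → ℝ)}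
    (hη : {i | η.1 i ∈ front u γ}.Infinite) (t : ℝ≥0) :
    (rescaledClock β u a c γ η).1 t - (rescaledFrontClock β u a c γ η).1 t =
      clusterTime β u a c γ η t := by
  simp only [rescaledClock, rescaledFrontClock, clusterTime, clock, frontTime]
  rw [← mul_sub]
  congr 1
  rw [sub_eq_iff_eq_add]
  set m := ⌊a * (t : ℝ)⌋₊
  have h := sum_filter_range_eq_sum_nth (fun i => η.1 i ∈ front u γ)
    (fun i => (holdingRate β u γ (η.1 i))⁻¹ * η.2 i) (stepsFor u γ η.1 m)
  have hv := visits_stepsFor hη m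
  rw [visits] at hv
  rw [hv] at h
  rw [← h, ← Finset.sum_add_distrib]
  refine Finset.sum_congr rfl fun i _ => ?_
  by_cases hi : η.1 i ∈ front u γ <;> simp [mem_clusters_iff_notMem_front, hi]

theorem holdingRate_nonneg (x : Cube n) : 0 ≤ holdingRate β u γ x := by
  refine mul_nonneg (by positivity) (Finset.sum_nonneg fun y _ => ?_)
  unfold metropolisWeight
  split_ifs <;> positivity

/-- Absolute values make this hold on every path, without discarding the null set where an
exponential variable is negative. -/
theorem ofReal_abs_clusterTime_le (hc : 0 < c) (η : (ℕ → Cube n) × (ℕ → ℝ)) (t : ℝ≥0) :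
    ENNReal.ofReal |clusterTime β u a c γ η t| ≤ ENNReal.ofReal c⁻¹ *
      weightedTime (front u γ) (clusters u γ)
        (fun x => ENNReal.ofReal (holdingRate β u γ x)⁻¹) ⌊a * (t : ℝ)⌋₊ η := by
  rw [clusterTime, abs_mul, abs_of_pos (inv_pos.mpr hc), ENNReal.ofReal_mul (inv_pos.mpr hc).le]
  gcongr
  set m := ⌊a * (t : ℝ)⌋₊
  calc _ ≤ ENNReal.ofReal (∑ i ∈ Finset.range (stepsFor u γ η.1 m),
        |if η.1 i ∈ clusters u γ then (holdingRate β u γ (η.1 i))⁻¹ * η.2 i else 0|) :=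
        ENNReal.ofReal_le_ofReal (Finset.abs_sum_le_sum_abs _ _)
    _ = ∑ i ∈ Finset.range (stepsFor u γ η.1 m), ENNReal.ofReal
        |if η.1 i ∈ clusters u γ then (holdingRate β u γ (η.1 i))⁻¹ * η.2 i else 0| :=
        ENNReal.ofReal_sum_of_nonneg fun _ _ => abs_nonneg _
    _ ≤ ∑ i ∈ Finset.range (stepsFor u γ η.1 m),
        {J : ℕ → Cube n | visits (front u γ) J i < m ∧
          J i ∈ (clusters u γ : Set (Cube n))}.indicator
            (fun J => ENNReal.ofReal (holdingRate β u γ (J i))⁻¹) η.1 *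
          ENNReal.ofReal |η.2 i| := by
        refine Finset.sum_le_sum fun i hi => ?_
        split_ifs with h
        · rw [indicator_of_mem, abs_mul, abs_of_nonneg (inv_nonneg.mpr (holdingRate_nonneg _)),
            ENNReal.ofReal_mul (inv_nonneg.mpr (holdingRate_nonneg _))]
          exact ⟨visits_lt_of_lt_stepsFor (Finset.mem_range.mp hi), h⟩
        · simp
    _ ≤ _ := ENNReal.sum_le_tsum _

/-! ### The neighbours of a vertex of the cube -/

section Neighbours

variable {n : ℕ}

/-- The neighbours of `x` in the hypercube. -/
def neighbours (x : Cube n) : Finset (Cube n) := Finset.univ.filter fun y => hammingDist x y = 1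

theorem mem_neighbours {x y : Cube n} : y ∈ neighbours x ↔ hammingDist x y = 1 := by
  simp [neighbours]

theorem card_neighbours (x : Cube n) : (neighbours x).card = n := by
  have hne : ∀ i, -x i ≠ x i := fun i => by
    rcases Int.units_eq_one_or (x i) with h | h <;> rw [h] <;> decide
  have h : neighbours x = Finset.univ.image fun i => Function.update x i (-x i) := by
    ext y
    simp only [mem_neighbours, Finset.mem_image, Finset.mem_univ, true_and]
    constructor
    · intro hy
      obtain ⟨i, hi⟩ := Finset.card_eq_one.mp hy
      refine ⟨i, funext fun j => ?_⟩
      have hj : x j ≠ y j ↔ j = i := by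
        have : j ∈ Finset.univ.filter (fun k => x k ≠ y k) ↔ j ∈ ({i} : Finset (Fin n)) := by
          rw [hi]
        simpa using this
      by_cases hji : j = i
      · subst hji
        have := hj.mpr rfl
        rw [Function.update_self]
        rcases Int.units_eq_one_or (x j) with h1 | h1 <;>
          rcases Int.units_eq_one_or (y j) with h2 | h2 <;> simp_all
      · rw [Function.update_of_ne hji]
        by_contra hne'
        exact hji (hj.mp hne')
    · rintro ⟨i, rfl⟩
      rw [hammingDist, Finset.card_eq_one]
      refine ⟨i, ?_⟩
      ext j
      by_cases hji : j = i
      · subst hji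
        simp
      · simp [hji]
  rw [h, Finset.card_image_of_injective, Finset.card_univ, Fintype.card_fin]
  intro i j hij
  by_contra hne'
  have := congrFun hij i
  simp only [Function.update_self] at this
  rw [Function.update_of_ne hne'] at this
  exact hne i this

end Neighbours

/-! ### Reversibility of the jump chain -/

section Metropolis

variable {n : ℕ} {β u : ℝ} {γ : Cube n → ℝ}

theorem mem_occupied {x : Cube n} : x ∈ occupied u γ ↔ γ x ≤ -u := by simp [occupied]

theorem hamiltonian_of_mem {x : Cube n} (hx : x ∈ occupied u γ) :
    hamiltonian u γ x = √(n : ℝ) * γ x := by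
  simp [hamiltonian, mem_occupied.mp hx]

theorem hamiltonian_of_notMem {x : Cube n} (hx : x ∉ occupied u γ) : hamiltonian u γ x = 0 := by
  simp [hamiltonian, mem_occupied.not.mp hx]

theorem hamiltonian_nonpos (hu : 0 ≤ u) (x : Cube n) : hamiltonian u γ x ≤ 0 := by
  unfold hamiltonian
  split_ifs with h
  · exact mul_nonpos_of_nonneg_of_nonpos (Real.sqrt_nonneg _) (by linarith)
  · exact le_rfl

theorem clusters_subset_occupied : clusters u γ ⊆ occupied u γ := Finset.sdiff_subset

theorem mem_clusters {x : Cube n} :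
    x ∈ clusters u γ ↔ x ∈ occupied u γ ∧ ∃ y ∈ neighbours x, y ∈ occupied u γ := by
  simp only [clusters, isolated, Finset.mem_sdiff, Finset.mem_filter, mem_neighbours]
  constructor
  · rintro ⟨h1, h2⟩
    push Not at h2
    exact ⟨h1, h2 h1⟩
  · rintro ⟨h1, y, hy, hy'⟩
    exact ⟨h1, fun h => h.2 y hy hy'⟩

/-- The conductance of the pair `x, y`. -/
def conductance (β u : ℝ) (γ : Cube n → ℝ) (x y : Cube n) : ℝ :=
  if hammingDist x y = 1 then
    Real.exp (-β * max (hamiltonian u γ x) (hamiltonian u γ y)) else 0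

theorem conductance_comm (x y : Cube n) : conductance β u γ x y = conductance β u γ y x := by
  simp only [conductance, hammingDist_comm x y, max_comm]

theorem conductance_nonneg (x y : Cube n) : 0 ≤ conductance β u γ x y := by
  unfold conductance; split_ifs <;> positivity

/-- `H x + (H y - H x)⁺ = max (H x) (H y)` is symmetric, which is the source of reversibility. -/
theorem exp_mul_metropolisWeight (x y : Cube n) :
    Real.exp (-β * hamiltonian u γ x) * metropolisWeight β u γ x y = conductance β u γ x y := by
  unfold metropolisWeight conductance
  split_ifs
  · rw [← Real.exp_add, ← mul_add]
    congr 2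
    rcases le_total (hamiltonian u γ x) (hamiltonian u γ y) with h | h
    · rw [max_eq_left (sub_nonneg.mpr h), max_eq_right h]; ring
    · rw [max_eq_right (sub_nonpos.mpr h), max_eq_left h]; ring
  · simp

theorem metropolisWeight_nonneg (x y : Cube n) : 0 ≤ metropolisWeight β u γ x y := by
  unfold metropolisWeight; split_ifs <;> positivity

theorem sum_metropolisWeight_pos (hn : 0 < n) (x : Cube n) :
    0 < ∑ y, metropolisWeight β u γ x y := by
  have hc : 0 < (neighbours x).card := by rwa [card_neighbours]
  obtain ⟨y, hy⟩ := Finset.card_pos.mp hc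
  refine Finset.sum_pos' (fun y _ => metropolisWeight_nonneg x y) ⟨y, Finset.mem_univ y, ?_⟩
  rw [metropolisWeight, if_pos (mem_neighbours.mp hy)]
  positivity

theorem holdingRate_pos (hn : 0 < n) (x : Cube n) : 0 < holdingRate β u γ x :=
  mul_pos (by positivity) (sum_metropolisWeight_pos hn x)

theorem jumpKernel_singleton (hn : 0 < n) (x y : Cube n) :
    jumpKernel β u γ x {y} =
      ENNReal.ofReal (metropolisWeight β u γ x y / ∑ z, metropolisWeight β u γ x z) := by
  have hpos := sum_metropolisWeight_pos (β := β) (u := u) (γ := γ) hn x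
  have hsum : ∑' z, ENNReal.ofReal (metropolisWeight β u γ x z) =
      ENNReal.ofReal (∑ z, metropolisWeight β u γ x z) := by
    rw [tsum_fintype, ENNReal.ofReal_sum_of_nonneg fun z _ => metropolisWeight_nonneg x z]
  have hne : ∑' z, ENNReal.ofReal (metropolisWeight β u γ x z) ≠ 0 := by
    rw [hsum]
    exact (ENNReal.ofReal_pos.mpr hpos).ne'
  change (jumpLaw β u γ x).toMeasure {y} = _
  rw [PMF.toMeasure_apply_singleton _ _ (measurableSet_singleton y), jumpLaw, dif_pos hne,
    PMF.normalize_apply, hsum, ENNReal.ofReal_div_of_pos hpos, div_eq_mul_inv]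

/-- The reversible measure of the jump chain, normalised on the front. -/
def reversibleWeight (β u : ℝ) (γ : Cube n → ℝ) (x : Cube n) : ℝ≥0∞ :=
  ENNReal.ofReal (Real.exp (-β * hamiltonian u γ x) * holdingRate β u γ x / (front u γ).card)

theorem exp_mul_holdingRate (x : Cube n) :
    Real.exp (-β * hamiltonian u γ x) * holdingRate β u γ x =
      (∑ y, conductance β u γ x y) / n := by
  rw [holdingRate, mul_left_comm, Finset.mul_sum]
  simp_rw [exp_mul_metropolisWeight]
  ring

/-- Detailed balance: the holding rate in the weight cancels the normalisation of the jump
probabilities and leaves the symmetric conductance. -/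
theorem reversibleWeight_mul_jumpKernel (hn : 0 < n) (x y : Cube n) :
    reversibleWeight β u γ x * jumpKernel β u γ x {y} =
      ENNReal.ofReal (conductance β u γ x y / n / (front u γ).card) := by
  have hpos := sum_metropolisWeight_pos (β := β) (u := u) (γ := γ) hn x
  have hh := (holdingRate_pos (β := β) (u := u) (γ := γ) hn x).le
  rw [jumpKernel_singleton hn, reversibleWeight, ← ENNReal.ofReal_mul (by positivity),
    ← exp_mul_metropolisWeight, holdingRate]
  congr 1
  have hn' : (n : ℝ) ≠ 0 := by positivity
  field_simp

theorem sum_reversibleWeight_mul_jumpKernel (hn : 0 < n) (y : Cube n) :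
    ∑ x, reversibleWeight β u γ x * jumpKernel β u γ x {y} = reversibleWeight β u γ y := by
  simp_rw [reversibleWeight_mul_jumpKernel hn, reversibleWeight, exp_mul_holdingRate]
  rw [← ENNReal.ofReal_sum_of_nonneg fun x _ => by
    have := conductance_nonneg (β := β) (u := u) (γ := γ) x y
    positivity]
  simp_rw [conductance_comm _ y, Finset.sum_div]

theorem conductance_of_notMem_occupied (hu : 0 ≤ u) {x y : Cube n} (hxy : hammingDist x y = 1)
    (h : x ∉ occupied u γ ∨ y ∉ occupied u γ) : conductance β u γ x y = 1 := by
  rw [conductance, if_pos hxy]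
  have hx := hamiltonian_nonpos (γ := γ) hu x
  have hy := hamiltonian_nonpos (γ := γ) hu y
  rcases h with h | h
  · rw [hamiltonian_of_notMem h, max_eq_left hy]; simp
  · rw [hamiltonian_of_notMem h, max_eq_right hx]; simp

/-- No edge at a front vertex has both endpoints occupied, so its `n` conductances all equal one.
Thus the uniform initial law is the restriction of the reversible weight to the front. -/
theorem reversibleWeight_of_mem_front (hn : 0 < n) (hu : 0 ≤ u) {x : Cube n}
    (hx : x ∈ front u γ) : reversibleWeight β u γ x = ENNReal.ofReal (1 / (front u γ).card) := by
  rw [reversibleWeight, exp_mul_holdingRate]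
  have h1 : ∑ y, conductance β u γ x y = n := by
    have h2 : ∀ y, conductance β u γ x y = if y ∈ neighbours x then 1 else 0 := by
      intro y
      split_ifs with hy
      · refine conductance_of_notMem_occupied hu (mem_neighbours.mp hy) ?_
        by_contra! h
        have : x ∈ clusters u γ := mem_clusters.mpr ⟨h.1, y, hy, h.2⟩
        exact mem_clusters_iff_notMem_front.mp this hx
      · rw [conductance, if_neg (mem_neighbours.not.mp hy)]
    simp_rw [h2]
    rw [Finset.sum_ite_mem, Finset.univ_inter]
    simp [card_neighbours]
  rw [h1, div_self (by positivity)]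

theorem uniformOn_front_singleton_of_notMem {x : Cube n} (hx : x ∉ front u γ) :
    uniformOn (front u γ : Set (Cube n)) {x} = 0 := by
  rw [uniformOn, cond_apply (Finset.measurableSet _)]
  have : (front u γ : Set (Cube n)) ∩ {x} = ∅ := by simpa using hx
  simp [this]

theorem uniformOn_front_singleton_le (hn : 0 < n) (hu : 0 ≤ u) (x : Cube n) :
    uniformOn (front u γ : Set (Cube n)) {x} ≤ reversibleWeight β u γ x := by
  by_cases hx : x ∈ front u γ
  · have hpos : 0 < (front u γ).card := Finset.card_pos.mpr ⟨x, hx⟩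
    rw [reversibleWeight_of_mem_front hn hu hx, uniformOn, cond_apply (Finset.measurableSet _),
      Measure.count_apply_finset, ENNReal.ofReal_div_of_pos (by positivity)]
    have : (front u γ : Set (Cube n)) ∩ {x} = {x} := by simpa using hx
    rw [this, Measure.count_singleton]
    simp
  · rw [uniformOn_front_singleton_of_notMem hx]
    exact zero_le

/-- Since `B` is closed under occupied neighbours, every edge entering it starts at an unoccupied
vertex and has conductance one; each vertex of `B` has at most `n` of them. -/
theorem sum_flow_le (hn : 0 < n) (hu : 0 ≤ u) {B : Finset (Cube n)}
    (hclosed : ∀ z ∈ B, ∀ x ∈ neighbours z, x ∈ occupied u γ → x ∈ B) :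
    ∑ x ∈ Bᶜ, ∑ z ∈ B, reversibleWeight β u γ x * jumpKernel β u γ x {z} ≤
      ENNReal.ofReal (B.card / (front u γ).card) := by
  simp_rw [reversibleWeight_mul_jumpKernel hn]
  have hnn : ∀ x z, 0 ≤ conductance β u γ x z / n / (front u γ).card := fun x z => by
    have := conductance_nonneg (β := β) (u := u) (γ := γ) x z
    positivity
  have h1 : ∀ x ∈ Bᶜ, ∑ z ∈ B, ENNReal.ofReal (conductance β u γ x z / n / (front u γ).card) =
      ENNReal.ofReal (∑ z ∈ B, conductance β u γ x z / n / (front u γ).card) := fun x _ =>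
    (ENNReal.ofReal_sum_of_nonneg fun z _ => hnn x z).symm
  rw [Finset.sum_congr rfl h1,
    ← ENNReal.ofReal_sum_of_nonneg fun x _ => Finset.sum_nonneg fun z _ => hnn x z]
  refine ENNReal.ofReal_le_ofReal ?_
  rw [Finset.sum_comm]
  have h2 : ∀ z ∈ B, ∑ x ∈ Bᶜ, conductance β u γ x z / n / (front u γ).card ≤
      1 / (front u γ).card := by
    intro z hz
    rw [← Finset.sum_div, ← Finset.sum_div]
    gcongr
    rw [div_le_one (by positivity)]
    calc ∑ x ∈ Bᶜ, conductance β u γ x z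
        ≤ ∑ x ∈ Bᶜ, if x ∈ neighbours z then (1 : ℝ) else 0 := by
          refine Finset.sum_le_sum fun x hx => ?_
          split_ifs with h
          · have hxo : x ∉ occupied u γ := fun ho =>
              Finset.mem_compl.mp hx (hclosed z hz x h ho)
            rw [conductance_of_notMem_occupied hu
              (by rw [hammingDist_comm]; exact mem_neighbours.mp h) (Or.inl hxo)]
          · rw [conductance, if_neg]
            rw [hammingDist_comm]
            exact mem_neighbours.not.mp h
      _ ≤ ∑ x, if x ∈ neighbours z then (1 : ℝ) else 0 :=
          Finset.sum_le_sum_of_subset_of_nonneg (Finset.subset_univ _)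
            fun x _ _ => by split_ifs <;> norm_num
      _ = n := by
          rw [Finset.sum_ite_mem, Finset.univ_inter]
          simp [card_neighbours]
  refine (Finset.sum_le_sum h2).trans (le_of_eq ?_)
  rw [Finset.sum_const, nsmul_eq_mul]
  ring

theorem isProbabilityMeasure_uniformOn_front (hne : (front u γ).Nonempty) :
    IsProbabilityMeasure (uniformOn (front u γ : Set (Cube n))) :=
  isProbabilityMeasure_uniformOn (Finset.finite_toSet _) (by simpa using hne)

/-- The time spent in the clusters before the `m`-th visit to the front, when each exponential
variable is replaced by its absolute value. -/
abbrev clusterOccupation (β u : ℝ) (γ : Cube n → ℝ) (m : ℕ) (η : (ℕ → Cube n) × (ℕ → ℝ)) :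
    ℝ≥0∞ :=
  weightedTime (front u γ) (clusters u γ) (fun x => ENNReal.ofReal (holdingRate β u γ x)⁻¹) m η

/-- The mean holding time cancels the holding rate in the reversible weight. What remains is `exp
(-β H x)`, the untruncated Boltzmann weight because cluster vertices are occupied. -/
theorem dynamicsLaw_lt_clusterOccupation_le (hn : 0 < n) (hu : 0 ≤ u)
    (hne : (front u γ).Nonempty) {B : Finset (Cube n)} (hB : B ⊆ clusters u γ)
    (hclosed : ∀ z ∈ B, ∀ x ∈ neighbours z, x ∈ occupied u γ → x ∈ B) (m : ℕ)
    {r : ℝ≥0∞} (hr0 : r ≠ 0) (hr : r ≠ ∞) :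
    dynamicsLaw β u γ {η | r < clusterOccupation β u γ m η} ≤
      m * ENNReal.ofReal (B.card / (front u γ).card) +
        (m * ∑ x ∈ clusters u γ \ B, ENNReal.ofReal (boltzmann β γ x / (front u γ).card)) *
          (∫⁻ x, ENNReal.ofReal |x| ∂(expMeasure 1)) / r := by
  have := isProbabilityMeasure_uniformOn_front hne
  have hd : Disjoint B (front u γ) := Finset.disjoint_left.mpr fun x hx =>
    mem_clusters_iff_notMem_front.mp (hB hx)
  have key := measure_lt_weightedTime_le (μ₀ := uniformOn (front u γ : Set (Cube n)))
    (κ := jumpKernel β u γ) (q := reversibleWeight β u γ)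
    (fun y => (sum_reversibleWeight_mul_jumpKernel hn y).le)
    (uniformOn_front_singleton_le hn hu)
    (fun x hx => uniformOn_front_singleton_of_notMem hx) m (clusters u γ) B hd
    (fun x => ENNReal.ofReal (holdingRate β u γ x)⁻¹) hr0 hr
  refine key.trans ?_
  gcongr with x hx
  · exact sum_flow_le hn hu hclosed
  · have hx' : x ∈ occupied u γ := clusters_subset_occupied (Finset.mem_sdiff.mp hx).1
    have hpos := holdingRate_pos (β := β) (u := u) (γ := γ) hn x
    rw [reversibleWeight, ← ENNReal.ofReal_mul (by positivity)]
    refine ENNReal.ofReal_le_ofReal (le_of_eq ?_)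
    rw [boltzmann, ← hamiltonian_of_mem hx']
    field_simp

theorem dynamicsLaw_ae_infinite (hn : 0 < n) (hu : 0 ≤ u) (hne : (front u γ).Nonempty) :
    ∀ᵐ η ∂(dynamicsLaw β u γ), {i | η.1 i ∈ front u γ}.Infinite := by
  have := isProbabilityMeasure_uniformOn_front hne
  have : IsProbabilityMeasure (expMeasure 1) := isProbabilityMeasure_expMeasure one_pos
  have h := ae_infinite_visits (μ₀ := uniformOn (front u γ : Set (Cube n)))
    (κ := jumpKernel β u γ) (q := reversibleWeight β u γ)
    (fun y => (sum_reversibleWeight_mul_jumpKernel hn y).le)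
    (uniformOn_front_singleton_le hn hu)
    (fun x hx => uniformOn_front_singleton_of_notMem hx) (fun x => ENNReal.ofReal_ne_top)
  exact (Measure.quasiMeasurePreserving_fst (μ := jumpChainLaw β u γ)
    (ν := Measure.infinitePi fun _ => expMeasure 1)).ae h

variable {a c : ℝ}

theorem ofReal_inv_mul_le {w : ℝ≥0∞} (hc : 0 < c) {δ : ℝ} (h : w ≤ ENNReal.ofReal (c * δ)) :
    ENNReal.ofReal c⁻¹ * w ≤ ENNReal.ofReal δ := by
  calc _ ≤ ENNReal.ofReal c⁻¹ * ENNReal.ofReal (c * δ) := by gcongr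
    _ = ENNReal.ofReal δ := by
      rw [← ENNReal.ofReal_mul (by positivity), inv_mul_cancel_left₀ hc.ne']

theorem dynamicsLaw_lt_clusterTime_le (hc : 0 < c) {δ : ℝ} (hδ : 0 < δ) (t : ℝ≥0) :
    dynamicsLaw β u γ {η | δ < clusterTime β u a c γ η t} ≤
      dynamicsLaw β u γ
        {η | ENNReal.ofReal (c * δ) < clusterOccupation β u γ ⌊a * (t : ℝ)⌋₊ η} := by
  refine measure_mono fun η hη => ?_
  by_contra hcon
  have h1 := (ofReal_abs_clusterTime_le (β := β) (u := u) (γ := γ) (a := a) hc η t).trans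
    (ofReal_inv_mul_le hc (not_lt.mp hcon))
  have h2 := (ENNReal.ofReal_le_ofReal_iff hδ.le).mp h1
  exact absurd (le_abs_self _ |>.trans h2) (not_le.mpr hη)

theorem dynamicsLaw_lt_skorokhodDist_le (hn : 0 < n) (hu : 0 ≤ u) (hne : (front u γ).Nonempty)
    (ha : 0 ≤ a) (hc : 0 < c) {δ : ℝ} (hδ : 0 < δ) {M : ℕ}
    (hM : (2⁻¹ : ℝ≥0∞) ^ M ≤ ENNReal.ofReal (δ / 2)) :
    dynamicsLaw β u γ {η | ENNReal.ofReal δ <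
        skorokhodDist (rescaledClock β u a c γ η) (rescaledFrontClock β u a c γ η)} ≤
      dynamicsLaw β u γ
        {η | ENNReal.ofReal (c * (δ / 2)) < clusterOccupation β u γ ⌊a * (M : ℝ)⌋₊ η} := by
  refine measure_mono_ae ?_
  filter_upwards [dynamicsLaw_ae_infinite (β := β) hn hu hne] with η hη hlt
  by_contra hcon
  refine absurd ?_ (not_le.mpr (show ENNReal.ofReal δ < _ from hlt))
  -- One half for the uniform distance on `[0, M]`, one half for the tail of the metric.
  have hδ2 : ENNReal.ofReal δ = ENNReal.ofReal (δ / 2) + ENNReal.ofReal (δ / 2) := by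
    rw [← ENNReal.ofReal_add (by positivity) (by positivity), add_halves]
  rw [hδ2]
  refine (skorokhodDist_le (M := M) (b := ENNReal.ofReal (δ / 2)) fun t ht => ?_).trans
    (by gcongr)
  rw [rescaledClock_sub_rescaledFrontClock hη]
  refine (ofReal_abs_clusterTime_le hc η t).trans (ofReal_inv_mul_le hc ?_)
  refine (weightedTime_mono_index (Nat.floor_mono ?_) η).trans (not_lt.mp hcon)
  gcongr
  exact_mod_cast ht

end Metropolis

/-! ### Gaussian tails and truncated exponential moments -/

theorem gaussianPDFReal_std (x : ℝ) :
    gaussianPDFReal 0 1 x = (√(2 * Real.pi))⁻¹ * Real.exp (-x ^ 2 / 2) := by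
  simp [gaussianPDFReal]

theorem gaussianReal_Iic_neg_le {s : ℝ} (hs : 0 ≤ s) :
    (gaussianReal 0 1).real (Iic (-s)) ≤ Real.exp (-s ^ 2 / 2) := by
  have h := measure_le_le_exp_mul_mgf (μ := gaussianReal 0 1) (X := id) (t := -s) (-s)
    (by linarith) (integrable_exp_mul_gaussianReal _)
  rw [mgf_id_gaussianReal] at h
  refine h.trans (le_of_eq ?_)
  rw [← Real.exp_add]
  congr 1
  simp
  ring

/-- On the interval of length `1 / s` to the left of `-s`, the exponent `x ^ 2 / 2` exceeds `s ^ 2 /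
2` by at most `1 + 1 / 2`. -/
theorem le_gaussianReal_Iic_neg {s : ℝ} (hs : 1 ≤ s) :
    ENNReal.ofReal (Real.exp (-(3 / 2)) * gaussianPDFReal 0 1 s / s) ≤
      gaussianReal 0 1 (Iic (-s)) := by
  have hs0 : 0 < s := by linarith
  calc ENNReal.ofReal (Real.exp (-(3 / 2)) * gaussianPDFReal 0 1 s / s)
      = ENNReal.ofReal (Real.exp (-(3 / 2)) * gaussianPDFReal 0 1 s) *
          volume (Icc (-s - 1 / s) (-s)) := by
        rw [Real.volume_Icc, ← ENNReal.ofReal_mul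
          (mul_nonneg (Real.exp_pos _).le (gaussianPDFReal_nonneg _ _ _))]
        congr 1
        ring
    _ = ∫⁻ _ in Icc (-s - 1 / s) (-s),
          ENNReal.ofReal (Real.exp (-(3 / 2)) * gaussianPDFReal 0 1 s) := by simp
    _ ≤ ∫⁻ x in Icc (-s - 1 / s) (-s), gaussianPDF 0 1 x := by
        refine setLIntegral_mono' measurableSet_Icc fun x hx => ?_
        refine ENNReal.ofReal_le_ofReal ?_
        rw [gaussianPDFReal_std, gaussianPDFReal_std, mul_left_comm, ← Real.exp_add]
        gcongr
        have h1 : (x + s) * (x + s) ≤ 1 := by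
          have h3 : 1 / s ≤ 1 := by rw [div_le_one hs0]; exact hs
          nlinarith [hx.1, hx.2]
        have h2 : -s * (x + s) ≤ 1 := by
          have : s * (1 / s) = 1 := by field_simp
          nlinarith [hx.1, hx.2]
        nlinarith
    _ = gaussianReal 0 1 (Icc (-s - 1 / s) (-s)) := (gaussianReal_apply 0 one_ne_zero _).symm
    _ ≤ _ := measure_mono Icc_subset_Iic_self

theorem gaussianReal_Iic_neg_one_pos : 0 < (gaussianReal 0 1).real (Iic (-1)) := by
  have hpdf := gaussianPDFReal_pos 0 1 1 one_ne_zero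
  have h : 0 < gaussianReal 0 1 (Iic (-1)) :=
    lt_of_lt_of_le (ENNReal.ofReal_pos.mpr (by positivity)) (le_gaussianReal_Iic_neg le_rfl)
  exact ENNReal.toReal_pos h.ne' (measure_ne_top _ _)

/-- Bounding `-x ^ 2 / 2` by its tangent at `-s` turns the integrand into a pure exponential of rate
`b - s`. -/
theorem setLIntegral_exp_gaussianReal_le {b s : ℝ} (hbs : s < b) :
    ∫⁻ x in Ioi (-s), ENNReal.ofReal (Real.exp (-b * x)) ∂(gaussianReal 0 1) ≤
      ENNReal.ofReal (Real.exp (b * s) * gaussianPDFReal 0 1 s / (b - s)) := by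
  have hbs' : 0 < b - s := sub_pos.mpr hbs
  rw [gaussianReal_of_var_ne_zero 0 one_ne_zero, restrict_withDensity measurableSet_Ioi,
    lintegral_withDensity_eq_lintegral_mul _ (measurable_gaussianPDF 0 1) (by fun_prop)]
  have hintegrable := integrableOn_exp_mul_Ioi (a := -(b - s)) (by linarith) (-s)
  calc _ ≤ ∫⁻ x in Ioi (-s), ENNReal.ofReal ((√(2 * Real.pi))⁻¹ * Real.exp (s ^ 2 / 2) *
          Real.exp (-(b - s) * x)) := by
        refine lintegral_mono fun x => ?_
        simp only [Pi.mul_apply, gaussianPDF]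
        rw [← ENNReal.ofReal_mul (gaussianPDFReal_nonneg _ _ _)]
        refine ENNReal.ofReal_le_ofReal ?_
        rw [gaussianPDFReal_std, mul_assoc, mul_assoc, ← Real.exp_add, ← Real.exp_add]
        refine mul_le_mul_of_nonneg_left (Real.exp_le_exp.mpr ?_) (by positivity)
        nlinarith [sq_nonneg (x + s)]
    _ = ENNReal.ofReal (∫ x in Ioi (-s), (√(2 * Real.pi))⁻¹ * Real.exp (s ^ 2 / 2) *
          Real.exp (-(b - s) * x)) :=
        (ofReal_integral_eq_lintegral_ofReal (hintegrable.const_mul _)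
          (ae_of_all _ fun x => by positivity)).symm
    _ = _ := by
        rw [integral_const_mul, integral_exp_mul_Ioi (by linarith), gaussianPDFReal_std]
        congr 1
        have h1 : Real.exp (b * s) * ((√(2 * Real.pi))⁻¹ * Real.exp (-s ^ 2 / 2)) =
            (√(2 * Real.pi))⁻¹ * Real.exp (s ^ 2 / 2) * Real.exp (-(b - s) * -s) := by
          rw [mul_left_comm, mul_assoc, ← Real.exp_add, ← Real.exp_add]
          congr 2
          ring
        rw [h1, neg_div_neg_eq]
        ring

theorem setLIntegral_exp_gaussianReal_le_mul {b s : ℝ} (hs : 1 ≤ s) (hbs : s < b) :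
    ∫⁻ x in Ioi (-s), ENNReal.ofReal (Real.exp (-b * x)) ∂(gaussianReal 0 1) ≤
      ENNReal.ofReal (Real.exp (3 / 2) * (s / (b - s)) * Real.exp (b * s)) *
        gaussianReal 0 1 (Iic (-s)) := by
  have hbs' : 0 < b - s := sub_pos.mpr hbs
  refine (setLIntegral_exp_gaussianReal_le hbs).trans ?_
  refine le_trans (le_of_eq ?_) (mul_le_mul_right (le_gaussianReal_Iic_neg hs) _)
  rw [← ENNReal.ofReal_mul (by positivity)]
  congr 1
  have h : Real.exp (3 / 2) * Real.exp (-(3 / 2)) = 1 := by rw [← Real.exp_add]; simp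
  have hs0 : s ≠ 0 := by positivity
  have hb0 : b - s ≠ 0 := hbs'.ne'
  calc _ = (Real.exp (3 / 2) * Real.exp (-(3 / 2))) *
        (Real.exp (b * s) * gaussianPDFReal 0 1 s / (b - s)) := by rw [h, one_mul]
    _ = _ := by field_simp

/-- Write `b = β √n` and `c = exp (b s)`, so that weight at least `c` means `g ≤ -s`. Since this has
probability about `1 / a`, Chernoff's bound gives `s ^ 2 ≤ 2 log (2 a)`, hence `s ≤ ρ √n` for a
fixed `ρ` strictly between `betaC ε` and `β`. Then `s / (b - s)` is bounded, and the truncated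
moment is at most a constant times `c` times the tail probability. -/
theorem exists_truncated_moment_bound {β ε : ℝ} (hε : 0 < ε) (hβ : betaC ε < β) {a c : ℕ → ℝ}
    (ha : Tendsto (fun n : ℕ => Real.log (a n) / ((n : ℝ) * Real.log 2)) atTop (𝓝 ε))
    (hac : Tendsto (fun n : ℕ => a n *
      (gaussianReal 0 1).real {x | c n ≤ Real.exp (-β * (√(n : ℝ) * x))}) atTop (𝓝 1)) :
    ∃ C : ℝ≥0∞, C ≠ ∞ ∧ ∀ᶠ n : ℕ in atTop, 0 < a n ∧ 0 < c n ∧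
      ENNReal.ofReal (a n) *
        gaussianReal 0 1 {x | c n ≤ Real.exp (-β * (√(n : ℝ) * x))} ≤ C ∧
      ENNReal.ofReal (a n * (c n)⁻¹) *
        ∫⁻ x in {x | Real.exp (-β * (√(n : ℝ) * x)) < c n},
          ENNReal.ofReal (Real.exp (-β * (√(n : ℝ) * x))) ∂(gaussianReal 0 1) ≤ C := by
  set μ := gaussianReal 0 1
  set p : ℕ → ℝ := fun n => μ.real {x | c n ≤ Real.exp (-β * (√(n : ℝ) * x))} with hp
  have hlog2 : 0 < Real.log 2 := Real.log_pos one_lt_two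
  have hβ0 : 0 < β := (Real.sqrt_nonneg _).trans_lt hβ
  obtain ⟨ρ, hρ1, hρ2⟩ := exists_between hβ
  have hρ0 : 0 < ρ := (Real.sqrt_nonneg _).trans_lt hρ1
  have hρε : ε * 2 * Real.log 2 < ρ ^ 2 := (Real.sqrt_lt' hρ0).mp hρ1
  have hnlog : Tendsto (fun n : ℕ => (n : ℝ) * Real.log 2) atTop atTop :=
    tendsto_natCast_atTop_atTop.atTop_mul_const hlog2
  have hloga : Tendsto (fun n => Real.log (a n)) atTop atTop := by
    refine (ha.pos_mul_atTop hε hnlog).congr' ?_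
    filter_upwards [eventually_gt_atTop 0] with n hn
    have : (n : ℝ) * Real.log 2 ≠ 0 := by positivity
    field_simp
  have hapos : ∀ᶠ n in atTop, 0 < a n := by
    filter_upwards [hac.eventually (lt_mem_nhds (zero_lt_one))] with n hn
    exact pos_of_mul_pos_left hn measureReal_nonneg
  have haTop : Tendsto a atTop atTop := by
    refine (Real.tendsto_exp_atTop.comp hloga).congr' ?_
    filter_upwards [hapos] with n hn
    exact Real.exp_log hn
  have hp0 : Tendsto p atTop (𝓝 0) := by
    have := hac.div_atTop haTop
    refine this.congr' ?_
    filter_upwards [hapos] with n hn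
    rw [mul_div_cancel_left₀ _ hn.ne']
  have hq1 : 0 < μ.real (Iic (-1)) := gaussianReal_Iic_neg_one_pos
  have hquot : ∀ᶠ n : ℕ in atTop, 2 * Real.log (2 * a n) ≤ ρ ^ 2 * n := by
    have h1 : Tendsto (fun n : ℕ => 2 * Real.log 2 * (Real.log (a n) / ((n : ℝ) * Real.log 2)) +
        2 * Real.log 2 / (n : ℝ)) atTop (𝓝 (2 * Real.log 2 * ε + 0)) :=
      (ha.const_mul _).add (tendsto_const_nhds.div_atTop tendsto_natCast_atTop_atTop)
    filter_upwards [h1.eventually (gt_mem_nhds (show 2 * Real.log 2 * ε + 0 < ρ ^ 2 by linarith)),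
      hapos, eventually_gt_atTop 0] with n h hn hn0
    have hn0' : (0 : ℝ) < n := by positivity
    rw [Real.log_mul two_ne_zero hn.ne']
    have h2 : 2 * Real.log 2 * (Real.log (a n) / ((n : ℝ) * Real.log 2)) + 2 * Real.log 2 / n =
        2 * (Real.log 2 + Real.log (a n)) / n := by field_simp; ring
    rw [h2, div_lt_iff₀ hn0'] at h
    exact h.le
  refine ⟨ENNReal.ofReal (max 2 (Real.exp (3 / 2) * (ρ / (β - ρ)) * 2)), ENNReal.ofReal_ne_top, ?_⟩
  filter_upwards [hapos, hquot, hp0.eventually (gt_mem_nhds hq1),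
    hp0.eventually (gt_mem_nhds one_pos), hac.eventually (gt_mem_nhds one_lt_two),
    hac.eventually (lt_mem_nhds (show (1 / 2 : ℝ) < 1 by norm_num)),
    eventually_gt_atTop 0] with n han hquotn hpn hpn1 hac2 hac1 hn
  have hn' : (0 : ℝ) < √(n : ℝ) := by positivity
  have hcn : 0 < c n := by
    -- For `c n ≤ 0` the tail event would be certain, but its probability is already below one.
    by_contra! hle
    have : {x : ℝ | c n ≤ Real.exp (-β * (√(n : ℝ) * x))} = univ :=
      eq_univ_of_forall fun x => hle.trans (Real.exp_pos _).le
    simp only [hp, this, probReal_univ, lt_irrefl] at hpn1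
  set b := β * √(n : ℝ) with hb
  have hb0 : 0 < b := by positivity
  set s := Real.log (c n) / b with hs
  have hexp : ∀ x : ℝ, -β * (√(n : ℝ) * x) = -b * x := fun x => by rw [hb]; ring
  have hcs : c n = Real.exp (b * s) := by
    rw [hs, mul_div_cancel₀ _ hb0.ne', Real.exp_log hcn]
  have hset : {x : ℝ | c n ≤ Real.exp (-β * (√(n : ℝ) * x))} = Iic (-s) := by
    ext x
    simp only [mem_ofPred_eq, mem_Iic]
    rw [hexp, hcs, Real.exp_le_exp]
    constructor <;> intro h <;> nlinarith
  have hset' : {x : ℝ | Real.exp (-β * (√(n : ℝ) * x)) < c n} = Ioi (-s) := by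
    ext x
    simp only [mem_ofPred_eq, mem_Ioi]
    rw [hexp, hcs, Real.exp_lt_exp]
    constructor <;> intro h <;> nlinarith
  have hpn_eq : p n = μ.real (Iic (-s)) := by rw [hp, ← hset]
  -- The lower Gaussian tail bound needs `s ≥ 1`; it holds since the tail probability has dropped
  -- below that of `Iic (-1)`.
  have hs1 : 1 ≤ s := by
    by_contra! hlt
    have : μ.real (Iic (-1)) ≤ p n := by
      rw [hpn_eq]
      exact measureReal_mono (Iic_subset_Iic.mpr (by linarith))
    linarith
  have hsle : s ≤ ρ * √(n : ℝ) := by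
    have h1 : p n ≤ Real.exp (-s ^ 2 / 2) := hpn_eq ▸ gaussianReal_Iic_neg_le (by linarith)
    have h2 : (2 * a n)⁻¹ ≤ Real.exp (-s ^ 2 / 2) := by
      refine le_trans ?_ h1
      rw [inv_le_iff_one_le_mul₀ (by positivity)]
      change 1 / 2 < a n * p n at hac1
      linarith
    have h3 := Real.log_le_log (by positivity) h2
    rw [Real.log_exp, Real.log_inv] at h3
    refine abs_le_of_sq_le_sq' ?_ (by positivity) |>.2
    rw [mul_pow, Real.sq_sqrt (by positivity)]
    linarith
  have hbs : (β - ρ) * √(n : ℝ) ≤ b - s := by rw [hb]; linarith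
  have hβρ : 0 < β - ρ := sub_pos.mpr hρ2
  have hbs0 : 0 < b - s := lt_of_lt_of_le (by positivity) hbs
  have hratio : s / (b - s) ≤ ρ / (β - ρ) := by
    rw [div_le_div_iff₀ hbs0 hβρ]
    nlinarith
  have hmul : ENNReal.ofReal (a n) * μ (Iic (-s)) ≤ ENNReal.ofReal 2 := by
    rw [← ofReal_measureReal (measure_ne_top _ _), ← ENNReal.ofReal_mul han.le, ← hpn_eq]
    exact ENNReal.ofReal_le_ofReal hac2.le
  refine ⟨han, hcn, ?_, ?_⟩
  · rw [hset]
    exact hmul.trans (ENNReal.ofReal_le_ofReal (le_max_left _ _))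
  · rw [hset']
    simp_rw [hexp]
    calc _ ≤ ENNReal.ofReal (a n * (c n)⁻¹) *
          (ENNReal.ofReal (Real.exp (3 / 2) * (s / (b - s)) * Real.exp (b * s)) *
            μ (Iic (-s))) := by
          gcongr
          exact setLIntegral_exp_gaussianReal_le_mul hs1 (by linarith)
      _ = ENNReal.ofReal (Real.exp (3 / 2) * (s / (b - s))) *
          (ENNReal.ofReal (a n) * μ (Iic (-s))) := by
          rw [← mul_assoc, ← mul_assoc, ← ENNReal.ofReal_mul (by positivity),
            ← ENNReal.ofReal_mul (by positivity), ← hcs]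
          congr 2
          field_simp
      _ ≤ ENNReal.ofReal (Real.exp (3 / 2) * (ρ / (β - ρ))) * ENNReal.ofReal 2 := by
          gcongr
      _ ≤ _ := by
          rw [← ENNReal.ofReal_mul (by positivity)]
          exact ENNReal.ofReal_le_ofReal (le_max_right _ _)

/-! ### Clusters containing a vertex of large Boltzmann weight -/

section Walks

variable {n : ℕ}

/-- The nearest-neighbour walks with `k` steps started from `x`, as lists of the vertices visited
after `x`. -/
def walks : ℕ → Cube n → Finset (List (Cube n))
  | 0, _ => {[]}
  | k + 1, x => (neighbours x).biUnion fun y => (walks k y).image (y :: ·)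

theorem card_walks_le (k : ℕ) (x : Cube n) : (walks k x).card ≤ n ^ k := by
  induction k generalizing x with
  | zero => simp [walks]
  | succ k ih =>
    calc (walks (k + 1) x).card ≤ ∑ y ∈ neighbours x, ((walks k y).image (y :: ·)).card :=
          Finset.card_biUnion_le
      _ ≤ ∑ y ∈ neighbours x, n ^ k :=
          Finset.sum_le_sum fun y _ => Finset.card_image_le.trans (ih y)
      _ = n ^ (k + 1) := by rw [Finset.sum_const, card_neighbours, smul_eq_mul, pow_succ']

theorem length_of_mem_walks {k : ℕ} {x : Cube n} {l : List (Cube n)} (hl : l ∈ walks k x) :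
    l.length = k := by
  induction k generalizing x l with
  | zero => simp_all [walks]
  | succ k ih =>
    simp only [walks, Finset.mem_biUnion, Finset.mem_image] at hl
    obtain ⟨y, _, l', hl', rfl⟩ := hl
    simp [ih hl']

/-- The graph of occupied vertices. -/
def occupiedGraph (u : ℝ) (γ : Cube n → ℝ) : SimpleGraph (Cube n) where
  Adj x y := x ∈ occupied u γ ∧ y ∈ occupied u γ ∧ hammingDist x y = 1
  symm := ⟨fun x y h => ⟨h.2.1, h.1, by rw [hammingDist_comm]; exact h.2.2⟩⟩
  loopless := ⟨fun x h => by simp at h⟩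

theorem tail_support_mem_walks {u : ℝ} {γ : Cube n → ℝ} {x z : Cube n}
    (p : (occupiedGraph u γ).Walk x z) :
    p.support.tail ∈ walks p.length x ∧ ∀ y ∈ p.support.tail, y ∈ occupied u γ := by
  induction p with
  | nil => simp [walks]
  | cons h p ih =>
    rename_i v _
    simp only [SimpleGraph.Walk.support_cons, List.tail_cons, SimpleGraph.Walk.length_cons, walks,
      Finset.mem_biUnion, Finset.mem_image]
    rw [← SimpleGraph.Walk.cons_tail_support p]
    refine ⟨⟨v, mem_neighbours.mpr h.2.2, _, ih.1, rfl⟩, ?_⟩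
    intro y hy
    rcases List.mem_cons.mp hy with rfl | hy
    · exact h.2.1
    · exact ih.2 y hy

open Classical in
/-- The union of the connected components of size at least two of the graph of occupied vertices
that contain a vertex of Boltzmann weight at least `c`. -/
def heavyClusters (β u c : ℝ) (γ : Cube n → ℝ) : Finset (Cube n) :=
  (clusters u γ).filter fun z => ∃ x ∈ clusters u γ, c ≤ boltzmann β γ x ∧
    (occupiedGraph u γ).Reachable x z

variable {β u c : ℝ} {γ : Cube n → ℝ}

theorem mem_heavyClusters {z : Cube n} : z ∈ heavyClusters β u c γ ↔ z ∈ clusters u γ ∧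
    ∃ x ∈ clusters u γ, c ≤ boltzmann β γ x ∧ (occupiedGraph u γ).Reachable x z := by
  simp [heavyClusters]

theorem heavyClusters_subset : heavyClusters β u c γ ⊆ clusters u γ := fun _ hz =>
  (mem_heavyClusters.mp hz).1

theorem heavyClusters_closed : ∀ z ∈ heavyClusters β u c γ, ∀ x ∈ neighbours z,
    x ∈ occupied u γ → x ∈ heavyClusters β u c γ := by
  intro z hz x hx hxo
  obtain ⟨hzc, y, hy, hcy, hr⟩ := mem_heavyClusters.mp hz
  have hzx := mem_neighbours.mp hx
  have hzo := clusters_subset_occupied hzc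
  refine mem_heavyClusters.mpr ⟨mem_clusters.mpr ⟨hxo, z, ?_, hzo⟩, y, hy, hcy, ?_⟩
  · rw [mem_neighbours, hammingDist_comm]
    exact hzx
  · exact hr.trans (SimpleGraph.Adj.reachable ⟨hzo, hxo, hzx⟩)

theorem boltzmann_lt_of_notMem_heavyClusters {x : Cube n} (hx : x ∈ clusters u γ)
    (h : x ∉ heavyClusters β u c γ) : boltzmann β γ x < c := by
  by_contra! hle
  exact h (mem_heavyClusters.mpr ⟨hx, x, hx, hle, SimpleGraph.Reachable.refl x⟩)

/-- A vertex `z` other than the heavy vertex `x` is the end of a path from `x` in its component. If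
`z = x`, it is charged to the one-step walk to an occupied neighbour, so that every walk has at
least one step and costs at least one extra occupied vertex. -/
theorem exists_walk_of_mem_heavyClusters {z : Cube n} (hz : z ∈ heavyClusters β u c γ) :
    ∃ x, ∃ k ∈ Finset.Icc 1 (Fintype.card (Cube n)),
      ∃ l ∈ (walks k x).filter fun l => (x :: l).Nodup,
        (c ≤ boltzmann β γ x ∧ ∀ y ∈ l, γ y ≤ -u) ∧ z ∈ ({x, (x :: l).getLast (by simp)} :
          Finset (Cube n)) := by
  obtain ⟨_, x, hx, hcx, hr⟩ := mem_heavyClusters.mp hz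
  refine ⟨x, ?_⟩
  by_cases hxz : x = z
  · subst hxz
    obtain ⟨_, y, hy, hyo⟩ := mem_clusters.mp hx
    refine ⟨1, Finset.mem_Icc.mpr ⟨le_rfl, Fintype.card_pos⟩, [y], ?_, ⟨hcx, ?_⟩, by simp⟩
    · have hne : x ≠ y := by
        rintro rfl
        simp [mem_neighbours] at hy
      simpa [walks, hne] using hy
    · simpa using mem_occupied.mp hyo
  · obtain ⟨p, hp⟩ := hr.exists_isPath
    have h1 := tail_support_mem_walks p
    have hsupp : p.support = x :: p.support.tail :=
      (SimpleGraph.Walk.cons_tail_support p).symm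
    refine ⟨p.length, ?_, p.support.tail, ?_, ⟨hcx, fun y hy => mem_occupied.mp (h1.2 y hy)⟩, ?_⟩
    · rw [Finset.mem_Icc]
      refine ⟨?_, hp.length_lt.le⟩
      rcases Nat.eq_zero_or_pos p.length with h0 | h0
      · exact absurd (SimpleGraph.Walk.eq_of_length_eq_zero h0) hxz
      · exact h0
    · rw [Finset.mem_filter]
      refine ⟨h1.1, ?_⟩
      rw [← hsupp]
      exact hp.support_nodup
    · simp

end Walks

/-! ### First moments of the environment -/

section Environment

variable {n : ℕ}

/-- The number of self-avoiding walks, with at least one step, that start from a vertex of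
Boltzmann weight at least `c` and continue along occupied vertices. -/
def heavyWalkCount (β u c : ℝ) (γ : Cube n → ℝ) : ℝ≥0∞ :=
  ∑ x, ∑ k ∈ Finset.Icc 1 (Fintype.card (Cube n)),
    ∑ l ∈ (walks k x).filter fun l => (x :: l).Nodup,
      {γ : Cube n → ℝ | c ≤ boltzmann β γ x ∧ ∀ y ∈ l, γ y ≤ -u}.indicator 1 γ

/-- The truncated Boltzmann weight of the vertices with an occupied neighbour. -/
def lightWeightSum (β u c : ℝ) (γ : Cube n → ℝ) : ℝ≥0∞ :=
  ∑ x, ∑ y ∈ neighbours x,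
    {r : ℝ | Real.exp (-β * (√(n : ℝ) * r)) < c}.indicator
      (fun r => ENNReal.ofReal (Real.exp (-β * (√(n : ℝ) * r)))) (γ x) *
        (Iic (-u)).indicator 1 (γ y)

/-- The number of edges with an occupied endpoint, each counted once for every such endpoint. -/
def occupiedEdgeCount (u : ℝ) (γ : Cube n → ℝ) : ℝ≥0∞ :=
  ∑ x, ∑ y ∈ neighbours x, (Iic (-u)).indicator 1 (γ y)

/-- The quantity controlling the time spent in the clusters. -/
def environmentError (β u a c : ℝ) (γ : Cube n → ℝ) : ℝ≥0∞ :=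
  (2 ^ n)⁻¹ * (ENNReal.ofReal a * heavyWalkCount β u c γ +
    ENNReal.ofReal (a * c⁻¹) * lightWeightSum β u c γ + occupiedEdgeCount u γ)

variable {β u a c : ℝ} {γ : Cube n → ℝ}

/-- Each walk is charged with at most two vertices, its start and its end. -/
theorem card_heavyClusters_le :
    ((heavyClusters β u c γ).card : ℝ≥0∞) ≤ 2 * heavyWalkCount β u c γ := by
  classical
  have hsub : heavyClusters β u c γ ⊆ Finset.univ.biUnion fun x =>
      (Finset.Icc 1 (Fintype.card (Cube n))).biUnion fun k =>
        ((walks k x).filter fun l => (x :: l).Nodup).biUnion fun l =>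
          if c ≤ boltzmann β γ x ∧ ∀ y ∈ l, γ y ≤ -u then
            ({x, (x :: l).getLast (by simp)} : Finset (Cube n)) else ∅ := by
    intro z hz
    obtain ⟨x, k, hk, l, hl, hev, hz'⟩ := exists_walk_of_mem_heavyClusters hz
    simp only [Finset.mem_biUnion]
    exact ⟨x, Finset.mem_univ x, k, hk, l, hl, by rw [if_pos hev]; exact hz'⟩
  have hcard : (heavyClusters β u c γ).card ≤ ∑ x, ∑ k ∈ Finset.Icc 1 (Fintype.card (Cube n)),
      ∑ l ∈ (walks k x).filter fun l => (x :: l).Nodup,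
        (if c ≤ boltzmann β γ x ∧ ∀ y ∈ l, γ y ≤ -u then 2 else 0) := by
    refine (Finset.card_le_card hsub).trans (Finset.card_biUnion_le.trans ?_)
    refine Finset.sum_le_sum fun x _ => Finset.card_biUnion_le.trans ?_
    refine Finset.sum_le_sum fun k _ => Finset.card_biUnion_le.trans ?_
    refine Finset.sum_le_sum fun l _ => ?_
    split_ifs
    · exact Finset.card_le_two
    · simp
  refine (Nat.cast_le.mpr hcard).trans (le_of_eq ?_)
  simp only [heavyWalkCount, Finset.mul_sum, Nat.cast_sum]
  refine Finset.sum_congr rfl fun x _ => Finset.sum_congr rfl fun k _ =>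
    Finset.sum_congr rfl fun l _ => ?_
  simp only [indicator, mem_ofPred_eq]
  split_ifs <;> simp

theorem sum_boltzmann_le :
    ∑ x ∈ clusters u γ \ heavyClusters β u c γ, ENNReal.ofReal (boltzmann β γ x) ≤
      lightWeightSum β u c γ := by
  refine le_trans ?_ (Finset.sum_le_sum_of_subset (Finset.subset_univ
    (clusters u γ \ heavyClusters β u c γ)))
  refine Finset.sum_le_sum fun x hx => ?_
  rw [Finset.mem_sdiff] at hx
  obtain ⟨_, y, hy, hyo⟩ := mem_clusters.mp hx.1
  have hlt := boltzmann_lt_of_notMem_heavyClusters hx.1 hx.2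
  refine le_trans (le_of_eq ?_) (Finset.single_le_sum (fun _ _ => zero_le) hy)
  rw [indicator_of_mem (show γ x ∈ {r : ℝ | Real.exp (-β * (√(n : ℝ) * r)) < c} from hlt),
    indicator_of_mem (show γ y ∈ Iic (-u) from mem_occupied.mp hyo), Pi.one_apply, mul_one]
  rfl

theorem card_clusters_le : ((clusters u γ).card : ℝ≥0∞) ≤ occupiedEdgeCount u γ := by
  rw [Finset.card_eq_sum_ones, Nat.cast_sum]
  refine le_trans ?_ (Finset.sum_le_sum_of_subset (Finset.subset_univ (clusters u γ)))
  refine Finset.sum_le_sum fun x hx => ?_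
  obtain ⟨_, y, hy, hyo⟩ := mem_clusters.mp hx
  refine le_trans (le_of_eq ?_) (Finset.single_le_sum (fun _ _ => zero_le) hy)
  rw [indicator_of_mem (show γ y ∈ Iic (-u) from mem_occupied.mp hyo)]
  simp

theorem measurable_boltzmann (x : Cube n) : Measurable fun γ : Cube n → ℝ => boltzmann β γ x := by
  unfold boltzmann; fun_prop

theorem measurableSet_heavyWalk (x : Cube n) (l : List (Cube n)) :
    MeasurableSet {γ : Cube n → ℝ | c ≤ boltzmann β γ x ∧ ∀ y ∈ l, γ y ≤ -u} := by
  have h1 : {γ : Cube n → ℝ | c ≤ boltzmann β γ x ∧ ∀ y ∈ l, γ y ≤ -u} =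
      {γ | c ≤ boltzmann β γ x} ∩ ⋂ y ∈ l.toFinset, {γ | γ y ≤ -u} := by
    ext γ; simp
  rw [h1]
  exact (measurableSet_le measurable_const (measurable_boltzmann x)).inter
    (Finset.measurableSet_biInter _ fun y _ =>
      measurableSet_le (measurable_pi_apply y) measurable_const)

theorem measurable_truncatedExp : Measurable
    ({r : ℝ | Real.exp (-β * (√(n : ℝ) * r)) < c}.indicator
      (fun r => ENNReal.ofReal (Real.exp (-β * (√(n : ℝ) * r))))) :=
  Measurable.indicator (by fun_prop) (measurableSet_lt (by fun_prop) measurable_const)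

theorem measurable_indicator_Iic : Measurable ((Iic (-u)).indicator (1 : ℝ → ℝ≥0∞)) :=
  measurable_one.indicator measurableSet_Iic

theorem measurable_heavyWalkCount :
    Measurable (heavyWalkCount β u c : (Cube n → ℝ) → ℝ≥0∞) := by
  unfold heavyWalkCount
  refine Finset.measurable_fun_sum _ fun x _ => Finset.measurable_fun_sum _ fun k _ =>
    Finset.measurable_fun_sum _ fun l _ => ?_
  exact measurable_one.indicator (measurableSet_heavyWalk x l)

theorem measurable_lightWeightSum :
    Measurable (lightWeightSum β u c : (Cube n → ℝ) → ℝ≥0∞) := by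
  unfold lightWeightSum
  refine Finset.measurable_fun_sum _ fun x _ => Finset.measurable_fun_sum _ fun y _ => ?_
  exact (measurable_truncatedExp.comp (measurable_pi_apply x)).mul
    (measurable_indicator_Iic.comp (measurable_pi_apply y))

theorem measurable_occupiedEdgeCount :
    Measurable (occupiedEdgeCount u : (Cube n → ℝ) → ℝ≥0∞) := by
  unfold occupiedEdgeCount
  refine Finset.measurable_fun_sum _ fun x _ => Finset.measurable_fun_sum _ fun y _ => ?_
  exact measurable_indicator_Iic.comp (measurable_pi_apply y)

theorem measurable_environmentError :
    Measurable (environmentError β u a c : (Cube n → ℝ) → ℝ≥0∞) := by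
  unfold environmentError
  exact (((measurable_heavyWalkCount.const_mul _).add
    (measurable_lightWeightSum.const_mul _)).add measurable_occupiedEdgeCount).const_mul _

variable {Ω : Type*} [MeasurableSpace Ω] {P : Measure Ω} {g : Cube n → Ω → ℝ}

theorem card_cube : (Fintype.card (Cube n) : ℝ≥0∞) = 2 ^ n := by
  simp

/-- A self-avoiding walk visits distinct vertices, so independence gives `h * p ^ k` for `k` steps.
There are at most `n ^ k` such walks, and since `k ≥ 1` a factor `n * p` comes out of a geometric
series of ratio at most one half. -/
theorem lintegral_heavyWalkCount_le (hlaw : ∀ x, HasLaw (g x) (gaussianReal 0 1) P)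
    (hindep : iIndepFun g P)
    (hnp : n * gaussianReal 0 1 (Iic (-u)) ≤ 2⁻¹) :
    ∫⁻ ω, heavyWalkCount β u c (fun x => g x ω) ∂P ≤
      2 ^ n * (gaussianReal 0 1 {r | c ≤ Real.exp (-β * (√(n : ℝ) * r))} *
        (2 * (n * gaussianReal 0 1 (Iic (-u))))) := by
  set p := gaussianReal 0 1 (Iic (-u))
  set h := gaussianReal 0 1 {r | c ≤ Real.exp (-β * (√(n : ℝ) * r))}
  have hg : AEMeasurable (fun ω x => g x ω) P :=
    aemeasurable_pi_lambda _ fun x => (hlaw x).aemeasurable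
  have hH : MeasurableSet {r : ℝ | c ≤ Real.exp (-β * (√(n : ℝ) * r))} :=
    measurableSet_le measurable_const (by fun_prop)
  have hwalk : ∀ x, ∀ k, ∀ l ∈ (walks k x).filter (fun l => (x :: l).Nodup),
      ∫⁻ ω, {γ : Cube n → ℝ | c ≤ boltzmann β γ x ∧ ∀ y ∈ l, γ y ≤ -u}.indicator 1
        (fun x => g x ω) ∂P = h * p ^ k := by
    intro x k l hl
    rw [Finset.mem_filter, List.nodup_cons] at hl
    set sets : Cube n → Set ℝ := fun y =>
      if y = x then {r | c ≤ Real.exp (-β * (√(n : ℝ) * r))} else Iic (-u) with hsets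
    have hms : ∀ y, MeasurableSet (sets y) := by
      intro y
      simp only [hsets]
      split_ifs
      exacts [hH, measurableSet_Iic]
    have hxl : x ∉ l.toFinset := by simpa using hl.2.1
    have hev : (fun ω x => g x ω) ⁻¹'
        {γ : Cube n → ℝ | c ≤ boltzmann β γ x ∧ ∀ y ∈ l, γ y ≤ -u} =
        ⋂ y ∈ insert x l.toFinset, g y ⁻¹' sets y := by
      ext ω
      simp only [mem_preimage, mem_ofPred_eq, Finset.mem_insert, List.mem_toFinset, mem_iInter,
        forall_eq_or_imp, hsets, if_true, boltzmann]
      refine and_congr Iff.rfl (forall₂_congr fun y hy => ?_)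
      have : y ≠ x := fun h => hl.2.1 (h ▸ hy)
      simp [this]
    have hpre : ∀ y, P (g y ⁻¹' sets y) = gaussianReal 0 1 (sets y) := fun y => by
      rw [← (hlaw y).map_eq, Measure.map_apply_of_aemeasurable (hlaw y).aemeasurable (hms y)]
    have h1 : ∫⁻ ω, {γ : Cube n → ℝ | c ≤ boltzmann β γ x ∧ ∀ y ∈ l, γ y ≤ -u}.indicator 1
        (fun x => g x ω) ∂P =
        P ((fun ω x => g x ω) ⁻¹'
          {γ : Cube n → ℝ | c ≤ boltzmann β γ x ∧ ∀ y ∈ l, γ y ≤ -u}) := by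
      rw [← lintegral_map' (measurable_one.indicator (measurableSet_heavyWalk x l)).aemeasurable
        hg, lintegral_indicator_one (measurableSet_heavyWalk x l),
        Measure.map_apply_of_aemeasurable hg (measurableSet_heavyWalk x l)]
    rw [h1, hev, hindep.measure_inter_preimage_eq_mul _ (fun y _ => hms y),
      Finset.prod_insert hxl, hpre, ← length_of_mem_walks hl.1, ← List.toFinset_card_of_nodup hl.2.2]
    congr 1
    · simp [hsets, h]
    · rw [Finset.prod_congr rfl (g := fun _ => p), Finset.prod_const]
      intro y hy
      have : y ≠ x := fun h => hxl (h ▸ hy)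
      rw [hpre]
      simp [hsets, this, p]
  have hmeas : ∀ x l, AEMeasurable (fun ω =>
      {γ : Cube n → ℝ | c ≤ boltzmann β γ x ∧ ∀ y ∈ l, γ y ≤ -u}.indicator
        (1 : (Cube n → ℝ) → ℝ≥0∞) (fun x => g x ω)) P := fun x l =>
    (measurable_one.indicator (measurableSet_heavyWalk x l)).comp_aemeasurable hg
  unfold heavyWalkCount
  rw [lintegral_finsetSum' _ fun x _ => Finset.aemeasurable_fun_sum _ fun k _ =>
    Finset.aemeasurable_fun_sum _ fun l _ => hmeas x l]
  have hx : ∀ x : Cube n, ∫⁻ ω, ∑ k ∈ Finset.Icc 1 (Fintype.card (Cube n)),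
      ∑ l ∈ (walks k x).filter fun l => (x :: l).Nodup,
        {γ : Cube n → ℝ | c ≤ boltzmann β γ x ∧ ∀ y ∈ l, γ y ≤ -u}.indicator
          (1 : (Cube n → ℝ) → ℝ≥0∞) (fun x => g x ω) ∂P ≤ h * (2 * (n * p)) := by
    intro x
    rw [lintegral_finsetSum' _ fun k _ => Finset.aemeasurable_fun_sum _ fun l _ => hmeas x l]
    calc _ ≤ ∑ k ∈ Finset.Icc 1 (Fintype.card (Cube n)), h * (n * p) ^ k := by
          refine Finset.sum_le_sum fun k _ => ?_
          rw [lintegral_finsetSum' _ fun l _ => hmeas x l, Finset.sum_congr rfl (hwalk x k),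
            Finset.sum_const, nsmul_eq_mul, mul_pow, mul_left_comm]
          gcongr
          exact_mod_cast (Finset.card_filter_le _ _).trans (card_walks_le k x)
      _ = h * ((n * p) * ∑ k ∈ Finset.range (Fintype.card (Cube n)), (n * p) ^ k) := by
          rw [← Finset.mul_sum]
          congr 1
          rw [Finset.mul_sum]
          simp_rw [← pow_succ']
          rw [Finset.range_eq_Ico, Finset.sum_Ico_add' (fun k => (n * p) ^ k), zero_add,
            Finset.Ico_add_one_right_eq_Icc]
      _ ≤ h * ((n * p) * ∑' k : ℕ, (2⁻¹ : ℝ≥0∞) ^ k) := by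
          gcongr
          refine le_trans (Finset.sum_le_sum fun k _ => ?_) (ENNReal.sum_le_tsum _)
          gcongr
      _ = h * (2 * (n * p)) := by
          rw [ENNReal.tsum_geometric, ENNReal.one_sub_inv_two, inv_inv, mul_comm _ (2 : ℝ≥0∞)]
  refine (Finset.sum_le_sum fun x _ => hx x).trans (le_of_eq ?_)
  rw [Finset.sum_const, Finset.card_univ, nsmul_eq_mul, card_cube]

theorem lintegral_lightWeightSum_eq (hlaw : ∀ x, HasLaw (g x) (gaussianReal 0 1) P)
    (hindep : iIndepFun g P) :
    ∫⁻ ω, lightWeightSum β u c (fun x => g x ω) ∂P =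
      2 ^ n * ((∫⁻ r in {r | Real.exp (-β * (√(n : ℝ) * r)) < c},
        ENNReal.ofReal (Real.exp (-β * (√(n : ℝ) * r))) ∂(gaussianReal 0 1)) *
          (n * gaussianReal 0 1 (Iic (-u)))) := by
  unfold lightWeightSum
  have hm : ∀ x y, AEMeasurable (fun ω => {r : ℝ | Real.exp (-β * (√(n : ℝ) * r)) < c}.indicator
      (fun r => ENNReal.ofReal (Real.exp (-β * (√(n : ℝ) * r)))) (g x ω) *
        (Iic (-u)).indicator (1 : ℝ → ℝ≥0∞) (g y ω)) P := fun x y =>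
    (measurable_truncatedExp.comp_aemeasurable (hlaw x).aemeasurable).mul
      (measurable_indicator_Iic.comp_aemeasurable (hlaw y).aemeasurable)
  rw [lintegral_finsetSum' _ fun x _ => Finset.aemeasurable_fun_sum _ fun y _ => hm x y]
  have hx : ∀ x : Cube n, ∫⁻ ω, ∑ y ∈ neighbours x,
      {r : ℝ | Real.exp (-β * (√(n : ℝ) * r)) < c}.indicator
        (fun r => ENNReal.ofReal (Real.exp (-β * (√(n : ℝ) * r)))) (g x ω) *
          (Iic (-u)).indicator (1 : ℝ → ℝ≥0∞) (g y ω) ∂P =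
      (∫⁻ r in {r | Real.exp (-β * (√(n : ℝ) * r)) < c},
        ENNReal.ofReal (Real.exp (-β * (√(n : ℝ) * r))) ∂(gaussianReal 0 1)) *
          (n * gaussianReal 0 1 (Iic (-u))) := by
    intro x
    rw [lintegral_finsetSum' _ fun y _ => hm x y, Finset.sum_congr rfl (g := fun _ =>
      (∫⁻ r in {r | Real.exp (-β * (√(n : ℝ) * r)) < c},
        ENNReal.ofReal (Real.exp (-β * (√(n : ℝ) * r))) ∂(gaussianReal 0 1)) *
          gaussianReal 0 1 (Iic (-u))), Finset.sum_const, card_neighbours, nsmul_eq_mul,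
      mul_left_comm]
    intro y hy
    have hne : x ≠ y := by
      rintro rfl
      simp [mem_neighbours] at hy
    have hind := (hindep.indepFun hne).comp
      (measurable_truncatedExp (n := n) (β := β) (c := c)) (measurable_indicator_Iic (u := u))
    have hmul := lintegral_mul_eq_lintegral_mul_lintegral_of_indepFun''
      (measurable_truncatedExp.comp_aemeasurable (hlaw x).aemeasurable)
      (measurable_indicator_Iic.comp_aemeasurable (hlaw y).aemeasurable) hind
    refine hmul.trans ?_
    congr 1
    · rw [← lintegral_indicator (measurableSet_lt (by fun_prop) measurable_const)]
      conv_rhs => rw [← (hlaw x).map_eq]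
      exact (lintegral_map' measurable_truncatedExp.aemeasurable (hlaw x).aemeasurable).symm
    · rw [← lintegral_indicator_one measurableSet_Iic]
      conv_rhs => rw [← (hlaw y).map_eq]
      exact (lintegral_map' measurable_indicator_Iic.aemeasurable (hlaw y).aemeasurable).symm
  simp_rw [hx]
  rw [Finset.sum_const, Finset.card_univ, nsmul_eq_mul, card_cube]

theorem lintegral_occupiedEdgeCount_eq (hlaw : ∀ x, HasLaw (g x) (gaussianReal 0 1) P) :
    ∫⁻ ω, occupiedEdgeCount u (fun x => g x ω) ∂P =
      2 ^ n * (n * gaussianReal 0 1 (Iic (-u))) := by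
  have hm : ∀ y, AEMeasurable (fun ω => (Iic (-u)).indicator (1 : ℝ → ℝ≥0∞) (g y ω)) P :=
    fun y => measurable_indicator_Iic.comp_aemeasurable (hlaw y).aemeasurable
  have hy : ∀ y, ∫⁻ ω, (Iic (-u)).indicator (1 : ℝ → ℝ≥0∞) (g y ω) ∂P =
      gaussianReal 0 1 (Iic (-u)) := fun y => by
    rw [← lintegral_indicator_one measurableSet_Iic]
    conv_rhs => rw [← (hlaw y).map_eq]
    exact (lintegral_map' measurable_indicator_Iic.aemeasurable (hlaw y).aemeasurable).symm
  unfold occupiedEdgeCount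
  rw [lintegral_finsetSum' _ fun x _ => Finset.aemeasurable_fun_sum _ fun y _ => hm y]
  have hx : ∀ x : Cube n, ∫⁻ ω, ∑ y ∈ neighbours x, (Iic (-u)).indicator (1 : ℝ → ℝ≥0∞) (g y ω) ∂P
      = n * gaussianReal 0 1 (Iic (-u)) := fun x => by
    rw [lintegral_finsetSum' _ fun y _ => hm y]
    simp_rw [hy]
    rw [Finset.sum_const, card_neighbours, nsmul_eq_mul]
  simp_rw [hx]
  rw [Finset.sum_const, Finset.card_univ, nsmul_eq_mul, card_cube]

/-- In the constant, `2 * C` comes from the heavy walks, `C` from the light vertices and `1` from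
the occupied edges. -/
theorem lintegral_environmentError_le (hlaw : ∀ x, HasLaw (g x) (gaussianReal 0 1) P)
    (hindep : iIndepFun g P) (hnp : n * gaussianReal 0 1 (Iic (-u)) ≤ 2⁻¹) {C : ℝ≥0∞}
    (hC : ENNReal.ofReal a * gaussianReal 0 1 {r | c ≤ Real.exp (-β * (√(n : ℝ) * r))} ≤ C)
    (hC' : ENNReal.ofReal (a * c⁻¹) *
      ∫⁻ r in {r | Real.exp (-β * (√(n : ℝ) * r)) < c},
        ENNReal.ofReal (Real.exp (-β * (√(n : ℝ) * r))) ∂(gaussianReal 0 1) ≤ C) :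
    ∫⁻ ω, environmentError β u a c (fun x => g x ω) ∂P ≤
      (3 * C + 1) * (n * gaussianReal 0 1 (Iic (-u))) := by
  have hg : AEMeasurable (fun ω x => g x ω) P :=
    aemeasurable_pi_lambda _ fun x => (hlaw x).aemeasurable
  have hA : AEMeasurable (fun ω => heavyWalkCount β u c fun x => g x ω) P :=
    measurable_heavyWalkCount.comp_aemeasurable hg
  have hL : AEMeasurable (fun ω => lightWeightSum β u c fun x => g x ω) P :=
    measurable_lightWeightSum.comp_aemeasurable hg
  have hO : AEMeasurable (fun ω => occupiedEdgeCount u fun x => g x ω) P :=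
    measurable_occupiedEdgeCount.comp_aemeasurable hg
  have h2 : (2 ^ n : ℝ≥0∞)⁻¹ * 2 ^ n = 1 := ENNReal.inv_mul_cancel (by simp) (by simp)
  unfold environmentError
  rw [lintegral_const_mul'' _ (by fun_prop),
    lintegral_add_right' _ hO, lintegral_add_right' _ (hL.const_mul _),
    lintegral_const_mul'' _ hA, lintegral_const_mul'' _ hL]
  rw [lintegral_lightWeightSum_eq hlaw hindep, lintegral_occupiedEdgeCount_eq hlaw]
  set p := gaussianReal 0 1 (Iic (-u))
  set h := gaussianReal 0 1 {r | c ≤ Real.exp (-β * (√(n : ℝ) * r))}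
  set I := ∫⁻ r in {r | Real.exp (-β * (√(n : ℝ) * r)) < c},
        ENNReal.ofReal (Real.exp (-β * (√(n : ℝ) * r))) ∂(gaussianReal 0 1)
  calc _ ≤ (2 ^ n)⁻¹ * (ENNReal.ofReal a * (2 ^ n * (h * (2 * (n * p)))) +
        ENNReal.ofReal (a * c⁻¹) * (2 ^ n * (I * (n * p))) + 2 ^ n * (n * p)) := by
        gcongr
        exact lintegral_heavyWalkCount_le hlaw hindep hnp
    _ = ((2 ^ n)⁻¹ * 2 ^ n) * (2 * (ENNReal.ofReal a * h) * (n * p) +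
        (ENNReal.ofReal (a * c⁻¹) * I) * (n * p) + n * p) := by ring
    _ ≤ 1 * (2 * C * (n * p) + C * (n * p) + n * p) := by
        rw [h2]
        gcongr
    _ = (3 * C + 1) * (n * p) := by ring

end Environment

/-! ### The time spent in the clusters -/

section Conclusion

variable {n : ℕ} {β u a c : ℝ} {γ : Cube n → ℝ}

/-- The edge count in the error bounds the proportion of cluster vertices, leaving at least half of
the cube in the front. -/
theorem two_pow_le_two_mul_card_front (hF : environmentError β u a c γ ≤ 2⁻¹) :
    2 ^ n ≤ 2 * (front u γ).card := by
  have h1 : ((clusters u γ).card : ℝ≥0∞) ≤ 2 ^ n * 2⁻¹ := by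
    calc _ ≤ occupiedEdgeCount u γ := card_clusters_le
      _ = 2 ^ n * ((2 ^ n)⁻¹ * occupiedEdgeCount u γ) := by
          rw [← mul_assoc, ENNReal.mul_inv_cancel (by simp) (by simp), one_mul]
      _ ≤ 2 ^ n * 2⁻¹ := by
          gcongr
          refine le_trans ?_ hF
          unfold environmentError
          gcongr
          exact le_add_self
  have h2 : (clusters u γ).card * 2 ≤ 2 ^ n := by
    have h3 : ((clusters u γ).card : ℝ≥0∞) * 2 ≤ 2 ^ n := by
      calc ((clusters u γ).card : ℝ≥0∞) * 2 ≤ 2 ^ n * 2⁻¹ * 2 := by gcongr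
        _ = 2 ^ n := by rw [mul_assoc, ENNReal.inv_mul_cancel (by simp) (by simp), mul_one]
    exact_mod_cast h3
  have h4 : (front u γ).card = 2 ^ n - (clusters u γ).card := by
    rw [front, Finset.card_sdiff_of_subset (Finset.subset_univ _), Finset.card_univ]
    simp
  omega

/-- The factor `4` combines two vertices per heavy walk with a front of at least half the cube; the
light part needs only `2`. -/
theorem dynamicsLaw_lt_clusterOccupation_le_environmentError (hn : 0 < n) (hu : 0 ≤ u)
    (ha : 0 < a) (hc : 0 < c) (hF : environmentError β u a c γ ≤ 2⁻¹) {δ : ℝ} (hδ : 0 < δ)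
    {T : ℝ} (hT : 0 ≤ T) :
    dynamicsLaw β u γ {η | ENNReal.ofReal (c * δ) < clusterOccupation β u γ ⌊a * T⌋₊ η} ≤
      ENNReal.ofReal (4 * T) * (1 + ENNReal.ofReal δ⁻¹ *
        ∫⁻ x, ENNReal.ofReal |x| ∂(expMeasure 1)) * environmentError β u a c γ := by
  have hZ := two_pow_le_two_mul_card_front hF
  have hZ0 : 0 < (front u γ).card := by
    have : 0 < 2 ^ n := by positivity
    omega
  have hZR : (0 : ℝ) < (front u γ).card := by exact_mod_cast hZ0
  have hZinv : ENNReal.ofReal ((front u γ).card : ℝ)⁻¹ ≤ 2 * (2 ^ n)⁻¹ := by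
    rw [ENNReal.ofReal_inv_of_pos hZR, ENNReal.ofReal_natCast, ENNReal.inv_le_iff_inv_le,
      ENNReal.mul_inv (by simp) (by simp), inv_inv, mul_comm, ← div_eq_mul_inv]
    refine ENNReal.div_le_of_le_mul' ?_
    exact_mod_cast hZ
  refine (dynamicsLaw_lt_clusterOccupation_le hn hu (Finset.card_pos.mp hZ0)
    heavyClusters_subset (heavyClusters_closed (β := β) (c := c)) _
    (ENNReal.ofReal_pos.mpr (by positivity)).ne' ENNReal.ofReal_ne_top).trans ?_
  have hm : ((⌊a * T⌋₊ : ℕ) : ℝ≥0∞) ≤ ENNReal.ofReal T * ENNReal.ofReal a := by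
    rw [← ENNReal.ofReal_mul hT, mul_comm T, ← ENNReal.ofReal_natCast]
    exact ENNReal.ofReal_le_ofReal (Nat.floor_le (by positivity))
  set Z : ℝ := ((front u γ).card : ℝ)
  set E := environmentError β u a c γ with hE
  set Cexp := ∫⁻ x, ENNReal.ofReal |x| ∂(expMeasure 1)
  have hE1 : ENNReal.ofReal a * ((2 ^ n)⁻¹ * heavyWalkCount β u c γ) ≤ E := by
    rw [mul_left_comm, hE, environmentError, add_assoc]
    gcongr
    exact le_self_add
  have hE2 : ENNReal.ofReal (a * c⁻¹) * ((2 ^ n)⁻¹ * lightWeightSum β u c γ) ≤ E := by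
    rw [mul_left_comm, hE, environmentError]
    gcongr
    exact le_add_self.trans le_self_add
  have h4T : ENNReal.ofReal (4 * T) = 4 * ENNReal.ofReal T := by
    rw [ENNReal.ofReal_mul (by norm_num)]
    simp
  have hfirst : ((⌊a * T⌋₊ : ℕ) : ℝ≥0∞) *
      ENNReal.ofReal ((heavyClusters β u c γ).card / Z) ≤ ENNReal.ofReal (4 * T) * E := by
    rw [div_eq_mul_inv, ENNReal.ofReal_mul (by positivity), ENNReal.ofReal_natCast]
    calc _ ≤ (ENNReal.ofReal T * ENNReal.ofReal a) *
          ((2 * heavyWalkCount β u c γ) * (2 * (2 ^ n)⁻¹)) := by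
          gcongr
          exact card_heavyClusters_le
      _ = 4 * ENNReal.ofReal T *
          (ENNReal.ofReal a * ((2 ^ n)⁻¹ * heavyWalkCount β u c γ)) := by ring
      _ ≤ _ := by rw [h4T]; gcongr
  have hsecond : ((⌊a * T⌋₊ : ℕ) : ℝ≥0∞) * (∑ x ∈ clusters u γ \ heavyClusters β u c γ,
      ENNReal.ofReal (boltzmann β γ x / Z)) * Cexp / ENNReal.ofReal (c * δ) ≤
      ENNReal.ofReal (4 * T) * (ENNReal.ofReal δ⁻¹ * Cexp) * E := by
    have hsum : ∑ x ∈ clusters u γ \ heavyClusters β u c γ,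
        ENNReal.ofReal (boltzmann β γ x / Z) ≤ lightWeightSum β u c γ * (2 * (2 ^ n)⁻¹) := by
      calc _ = (∑ x ∈ clusters u γ \ heavyClusters β u c γ,
            ENNReal.ofReal (boltzmann β γ x)) * ENNReal.ofReal Z⁻¹ := by
            rw [Finset.sum_mul]
            refine Finset.sum_congr rfl fun x _ => ?_
            have hw : 0 ≤ boltzmann β γ x := (Real.exp_pos _).le
            rw [div_eq_mul_inv, ENNReal.ofReal_mul hw]
        _ ≤ _ := by
            gcongr
            exact sum_boltzmann_le
    have hinv : (ENNReal.ofReal (c * δ))⁻¹ = ENNReal.ofReal c⁻¹ * ENNReal.ofReal δ⁻¹ := by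
      rw [← ENNReal.ofReal_inv_of_pos (by positivity), mul_inv, ENNReal.ofReal_mul (by positivity)]
    rw [div_eq_mul_inv, hinv]
    calc _ ≤ (ENNReal.ofReal T * ENNReal.ofReal a) *
          (lightWeightSum β u c γ * (2 * (2 ^ n)⁻¹)) * Cexp *
            (ENNReal.ofReal c⁻¹ * ENNReal.ofReal δ⁻¹) := by gcongr
      _ = 2 * ENNReal.ofReal T * (ENNReal.ofReal δ⁻¹ * Cexp) *
          (ENNReal.ofReal a * ENNReal.ofReal c⁻¹ * ((2 ^ n)⁻¹ * lightWeightSum β u c γ)) := by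
          ring
      _ ≤ 4 * ENNReal.ofReal T * (ENNReal.ofReal δ⁻¹ * Cexp) * E := by
          rw [← ENNReal.ofReal_mul ha.le]
          gcongr
          norm_num
      _ = _ := by rw [h4T]
  refine (add_le_add hfirst hsecond).trans (le_of_eq ?_)
  ring

end Conclusion

/-- The expected errors are summable because `1 - cstar < -1`, so by Tonelli the series of errors
converges almost surely. Only the law of each environment separately enters. -/
theorem tendsto_environmentError {Ω : Type*} [MeasurableSpace Ω] {P : Measure Ω}
    {g : (n : ℕ) → Cube n → Ω → ℝ} {β cstar : ℝ} {u a c : ℕ → ℝ} {C : ℝ≥0∞}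
    (hlaw : ∀ n x, HasLaw (g n x) (gaussianReal 0 1) P) (hindep : ∀ n, iIndepFun (g n) P)
    (hcstar : 2 < cstar)
    (hu : ∀ᶠ n : ℕ in atTop,
      n * gaussianReal 0 1 (Iic (-u n)) = ENNReal.ofReal ((n : ℝ) ^ (1 - cstar)))
    (hC : C ≠ ∞)
    (hbound : ∀ᶠ n : ℕ in atTop, 0 < a n ∧ 0 < c n ∧
      ENNReal.ofReal (a n) *
        gaussianReal 0 1 {x | c n ≤ Real.exp (-β * (√(n : ℝ) * x))} ≤ C ∧
      ENNReal.ofReal (a n * (c n)⁻¹) *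
        ∫⁻ x in {x | Real.exp (-β * (√(n : ℝ) * x)) < c n},
          ENNReal.ofReal (Real.exp (-β * (√(n : ℝ) * x))) ∂(gaussianReal 0 1) ≤ C) :
    ∀ᵐ ω ∂P, Tendsto (fun n => environmentError β (u n) (a n) (c n) fun x => g n x ω)
      atTop (𝓝 0) := by
  have hzero : Tendsto (fun n : ℕ => ENNReal.ofReal ((n : ℝ) ^ (1 - cstar))) atTop (𝓝 0) := by
    have h1 : Tendsto (fun n : ℕ => (n : ℝ) ^ (-(cstar - 1))) atTop (𝓝 0) :=
      (tendsto_rpow_neg_atTop (by linarith)).comp tendsto_natCast_atTop_atTop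
    rw [neg_sub] at h1
    simpa using ENNReal.tendsto_ofReal h1
  have hev : ∀ᶠ n : ℕ in atTop, ∫⁻ ω, environmentError β (u n) (a n) (c n) (fun x => g n x ω) ∂P ≤
      (3 * C + 1) * ENNReal.ofReal ((n : ℝ) ^ (1 - cstar)) := by
    filter_upwards [hu, hbound, hzero.eventually (gt_mem_nhds (show (0 : ℝ≥0∞) < 2⁻¹ by simp))]
      with n hun hbn hzn
    rw [← hun] at hzn ⊢
    exact lintegral_environmentError_le (hlaw n) (hindep n) hzn.le hbn.2.2.1 hbn.2.2.2
  obtain ⟨N, hN⟩ := eventually_atTop.mp hev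
  have hmeas : ∀ n, AEMeasurable
      (fun ω => environmentError β (u n) (a n) (c n) fun x => g n x ω) P := fun n =>
    measurable_environmentError.comp_aemeasurable
      (aemeasurable_pi_lambda _ fun x => (hlaw n x).aemeasurable)
  have hfin : ∫⁻ ω, ∑' n, environmentError β (u (n + N)) (a (n + N)) (c (n + N))
      (fun x => g (n + N) x ω) ∂P ≠ ∞ := by
    rw [lintegral_tsum fun n => hmeas (n + N)]
    refine ne_top_of_le_ne_top ?_ (ENNReal.tsum_le_tsum fun n => hN (n + N) (by omega))
    rw [ENNReal.tsum_mul_left]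
    refine ENNReal.mul_ne_top
      (ENNReal.add_ne_top.mpr ⟨ENNReal.mul_ne_top (by simp) hC, by simp⟩) ?_
    have hs : Summable fun n : ℕ => (n : ℝ) ^ (1 - cstar) :=
      Real.summable_nat_rpow.mpr (by linarith)
    exact ((summable_nat_add_iff N).mpr hs).tsum_ofReal_ne_top
  filter_upwards [ae_lt_top' (AEMeasurable.tsum fun n => hmeas (n + N)) hfin] with ω hω
  rw [← tendsto_add_atTop_iff_nat N]
  exact ENNReal.tendsto_atTop_zero_of_tsum_ne_top hω.ne

end TruncatedREM

end

open TruncatedREM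
theorem theorem3p3 {Ω : Type*} [MeasurableSpace Ω] (P : Measure Ω) [IsProbabilityMeasure P]
    (g : (n : ℕ) → Cube n → Ω → ℝ)
    (hg_law : ∀ n x, HasLaw (g n x) (gaussianReal 0 1) P)
    (hg_indep : ∀ n, iIndepFun (g n) P)
    (cstar : ℝ) (hcstar : 2 < cstar)
    (u : ℕ → ℝ)
    (hu : ∀ n, 2 ≤ n → ∀ x, P.real {ω | g n x ω ≤ -u n} = (n : ℝ) ^ (-cstar))
    (ε : ℝ) (hε0 : 0 < ε) (hε1 : ε < 1) (β : ℝ) (hβ : betaC ε < β)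
    (a c : ℕ → ℝ)
    (ha : Tendsto (fun n : ℕ => Real.log (a n) / ((n : ℝ) * Real.log 2)) atTop (𝓝 ε))
    (hac : ∀ x : (n : ℕ) → Cube n,
      Tendsto (fun n => a n * P.real {ω | c n ≤ boltzmann β (fun y => g n y ω) (x n)})
        atTop (𝓝 1)) :
    ∀ᵐ ω ∂P, ∀ δ : ℝ, 0 < δ →
      Tendsto (fun n => dynamicsLaw β (u n) (fun y => g n y ω)
        {η | ENNReal.ofReal δ < skorokhodDist
          (rescaledClock β (u n) (a n) (c n) (fun y => g n y ω) η)
          (rescaledFrontClock β (u n) (a n) (c n) (fun y => g n y ω) η)}) atTop (𝓝 0) ∧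
      ∀ t : ℝ≥0, Tendsto (fun n => dynamicsLaw β (u n) (fun y => g n y ω)
        {η | δ < clusterTime β (u n) (a n) (c n) (fun y => g n y ω) η t}) atTop (𝓝 0) := by
  have hac' : Tendsto (fun n : ℕ => a n *
      (gaussianReal 0 1).real {x | c n ≤ Real.exp (-β * (√(n : ℝ) * x))}) atTop (𝓝 1) := by
    refine (hac fun n => 1).congr fun n => ?_
    congr 1
    exact (hg_law n 1).measureReal_eq (p := fun r => c n ≤ Real.exp (-β * (√(n : ℝ) * r)))
      (measurableSet_le measurable_const (by fun_prop))
  obtain ⟨C, hC, hbound⟩ := exists_truncated_moment_bound hε0 hβ ha hac'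
  have hp : ∀ n, 2 ≤ n → (gaussianReal 0 1).real (Iic (-u n)) = (n : ℝ) ^ (-cstar) := by
    intro n hn
    rw [← hu n hn 1]
    exact ((hg_law n 1).measureReal_eq (p := fun r => r ≤ -u n) measurableSet_Iic).symm
  have hnp : ∀ᶠ n : ℕ in atTop,
      n * gaussianReal 0 1 (Iic (-u n)) = ENNReal.ofReal ((n : ℝ) ^ (1 - cstar)) := by
    filter_upwards [eventually_ge_atTop 2] with n hn
    have hn0 : (0 : ℝ) < n := by positivity
    rw [← ofReal_measureReal (measure_ne_top _ _), hp n hn, ← ENNReal.ofReal_natCast,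
      ← ENNReal.ofReal_mul hn0.le, sub_eq_add_neg, Real.rpow_add hn0, Real.rpow_one]
  -- A negative `u n` would give an occupation probability of at least that of `Iic 0`, while `n ^
  -- (-cstar)` tends to zero.
  have hupos : ∀ᶠ n in atTop, 0 ≤ u n := by
    have h0 : 0 < (gaussianReal 0 1).real (Iic 0) :=
      gaussianReal_Iic_neg_one_pos.trans_le
        (measureReal_mono (Iic_subset_Iic.mpr (by norm_num)))
    have h1 : Tendsto (fun n : ℕ => (n : ℝ) ^ (-cstar)) atTop (𝓝 0) :=
      (tendsto_rpow_neg_atTop (by linarith)).comp tendsto_natCast_atTop_atTop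
    filter_upwards [eventually_ge_atTop 2, h1.eventually (gt_mem_nhds h0)] with n hn hlt
    by_contra! hneg
    rw [← hp n hn] at hlt
    exact absurd (measureReal_mono (Iic_subset_Iic.mpr (by linarith))) (not_le.mpr hlt)
  -- The error involves neither `δ` nor `t`, so one null set serves for all of them.
  filter_upwards [tendsto_environmentError hg_law hg_indep hcstar hnp hC hbound] with ω hω δ hδ
  have hgood := hω.eventually (gt_mem_nhds (show (0 : ℝ≥0∞) < 2⁻¹ by simp))
  have hlim : ∀ T δ' : ℝ, Tendsto (fun n => ENNReal.ofReal (4 * T) * (1 + ENNReal.ofReal δ'⁻¹ *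
      ∫⁻ x, ENNReal.ofReal |x| ∂(expMeasure 1)) *
        environmentError β (u n) (a n) (c n) fun x => g n x ω) atTop (𝓝 0) := by
    intro T δ'
    rw [← mul_zero (ENNReal.ofReal (4 * T) * (1 + ENNReal.ofReal δ'⁻¹ *
      ∫⁻ x, ENNReal.ofReal |x| ∂(expMeasure 1)))]
    refine ENNReal.Tendsto.const_mul hω (Or.inr ?_)
    refine ENNReal.mul_ne_top ENNReal.ofReal_ne_top (ENNReal.add_ne_top.mpr ⟨by simp, ?_⟩)
    exact ENNReal.mul_ne_top ENNReal.ofReal_ne_top lintegral_abs_expMeasure_lt_top.ne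
  constructor
  · obtain ⟨M, hM⟩ := ENNReal.exists_inv_two_pow_lt
      (ENNReal.ofReal_pos.mpr (half_pos hδ)).ne'
    refine tendsto_of_tendsto_of_tendsto_of_le_of_le' tendsto_const_nhds (hlim M (δ / 2))
      (Eventually.of_forall fun _ => zero_le) ?_
    filter_upwards [hgood, hupos, hbound, eventually_gt_atTop 0] with n hgn hun hbn hn
    have hZ := two_pow_le_two_mul_card_front hgn.le
    have hne : (front (u n) fun y => g n y ω).Nonempty := by
      rw [← Finset.card_pos]
      have : 0 < 2 ^ n := by positivity
      omega
    exact (dynamicsLaw_lt_skorokhodDist_le hn hun hne hbn.1.le hbn.2.1 hδ hM.le).trans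
      (dynamicsLaw_lt_clusterOccupation_le_environmentError hn hun hbn.1 hbn.2.1 hgn.le
        (half_pos hδ) (Nat.cast_nonneg M))
  · intro t
    refine tendsto_of_tendsto_of_tendsto_of_le_of_le' tendsto_const_nhds (hlim t δ)
      (Eventually.of_forall fun _ => zero_le) ?_
    filter_upwards [hgood, hupos, hbound, eventually_gt_atTop 0] with n hgn hun hbn hn
    exact (dynamicsLaw_lt_clusterTime_le hbn.2.1 hδ t).trans
      (dynamicsLaw_lt_clusterOccupation_le_environmentError hn hun hbn.1 hbn.2.1 hgn.le hδ t.2)
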